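/- Consider the one-or-all multiserver-job system with $k\ge 2$ servers: small jobs (each needing one server) and large jobs (each needing all $k$ servers) arrive as independent Poisson processes of rates $\lambda_1>0$ and $\lambda_k>0$, service durations are independent and exponential of rates $\mu_1>0$ and $\mu_k>0$, jobs are not preempted, and the system is stable: $\frac{\lambda_1}{k\mu_1}+\frac{\lambda_k}{\mu_k}<1$. The system runs as a continuous-time Markov chain under the Most-Servers-First-Quickswap policy with threshold $\ell\in\{0,\dots,k-1\}$, started from an arbitrary initial distribution, which cycles through four phases: * phase 1: large jobs are served, one at a time, until none remain; * phase 2: small jobs are served until fewer than $k$ small jobs are in the system (an empty system idles in phase 2 until the next arrival); * phase 3: small jobs are served until at most $\ell$ of them are in service; * phase 4: the small jobs in service are completed, and no job is admitted to service; then phase 1 begins. A phase whose end condition already holds when it begins has length zero. Fix $c\ge 0$ and consider the $c$-th cycle, consisting of phases 2, 3, 4 and the subsequent phase 1. Suppose that with positive probability this cycle takes place and at least $k$ small jobs are present at the beginning of its phase 2, and condition on that event. Let $H_2,H_3,H_4$ be the durations of phases 2, 3, 4 of the cycle, let $N_1^L$ be the number of large jobs at the beginning of its phase 1, and let $N_2^S$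 be the number of small jobs at the beginning of the phase 2 that follows this phase 1. For an integer-valued $N\ge 0$ and a real $H\ge 0$ write $\widehat N(z)=\mathbb E[z^{N}]$ and $\widetilde H(s)=\mathbb E[e^{-sH}]$ (with respect to the conditional law for the quantities of the cycle). Let $B^L_{S_k}$ be the busy period of large jobs, i.e. the time until an M/M/1 queue with arrival rate $\lambda_k$ and service rate $\mu_k$ that starts with exactly one job becomes empty. Then almost surely all four phases of the cycle end, $B^L_{S_k}$ is almost surely finite, and for every complex $z$ with $|z|\le 1$, \[ \widehat{N_1^L}(z)=\widetilde{H_2}(\lambda_k(1-z))\,\widetilde{H_3}(\lambda_k(1-z))\,\widetilde{H_4}(\lambda_k(1-z)), \] \[ \widehat{N_2^S}(z)=\widetilde{H_2}(\lambda_k(1-\beta(z)))\,\widetilde{H_3}(\lambda_k(1-\beta(z)))\,\widetilde{H_4}\bigl(\lambda_k(1-\beta(z))+\lambda_1(1-z)\bigr), \qquad \beta(z)=\widetilde{B^L_{S_k}}(\lambda_1(1-z)). \] -/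

import Mathlib

open MeasureTheory ProbabilityTheory

namespace MSFQ

/-! ### Markov renewal processes (jump chain and holding times) -/

/-- `(X, T)` is, under `P`, the sequence of states visited (`X n`) and of times spent in them
(`T n`) of a jump process on a countable set `S` whose sojourn in state `x` has law `hold x` and
which, independently of the sojourn, moves from `x` to `y` with probability `jump x y`.  The
initial law is arbitrary.  With exponential holding laws this is the usual description of a
continuous-time Markov chain by its jump chain and its holding times. -/
structure IsJumpProcess {S Ω : Type*} [MeasurableSpace Ω] (hold : S → Measure ℝ)
    (jump : S → S → ENNReal) (P : Measure Ω) (X : ℕ → Ω → S) (T : ℕ → Ω → ℝ) : Prop where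
  measurable_state : ∀ n x, MeasurableSet {ω | X n ω = x}
  measurable_time : ∀ n, Measurable (T n)
  law : ∀ (n : ℕ) (x : ℕ → S) (B : ℕ → Set ℝ), (∀ i, MeasurableSet (B i)) →
    P {ω | (∀ i ≤ n, X i ω = x i) ∧ ∀ i < n, T i ω ∈ B i} =
      P {ω | X 0 ω = x 0} *
        ∏ i ∈ Finset.range n, (hold (x i) (B i) * jump (x i) (x (i + 1)))

/-! ### The one-or-all system under the MSFQ policy -/

/-- The four phases of the policy. -/
inductive Phase : Type
  | one | two | three | four
  deriving DecidableEq

/-- Phase `1` follows phase `4`. -/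
def Phase.next : Phase → Phase
  | .one => .two
  | .two => .three
  | .three => .four
  | .four => .one

/-- The system state: current phase, numbers `nS`, `nL` of small (one-server) and large
(`k`-server) jobs in the system, numbers `uS`, `uL` of small and large jobs in service. -/
@[ext] structure State : Type where
  phase : Phase
  nS : ℕ
  nL : ℕ
  uS : ℕ
  uL : ℕ
  deriving DecidableEq

/-- Admission to service: in phase 1 only large jobs are served, one at a time; in phases 2 and 3
small jobs are admitted to the `k` servers; in phase 4 nothing is admitted. -/
def State.admit (k : ℕ) (x : State) : State :=
  match x.phase with
  | .one => { x with uS := 0, uL := min x.nL 1 }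
  | .two => { x with uS := min x.nS k, uL := 0 }
  | .three => { x with uS := min x.nS k, uL := 0 }
  | .four => { x with uL := 0 }

/-- The current phase is over.  Phase 1 ends when no large job remains; phase 2 when fewer than `k`
small jobs are in the system (an empty system idles in phase 2 until the next arrival); phase 3 when
at most `l` small jobs are in service; phase 4 when the small jobs in service are completed. -/
def State.PhaseOver (k l : ℕ) (x : State) : Prop :=
  match x.phase with
  | .one => x.nL = 0
  | .two => x.nS < k ∧ ¬ (x.nS = 0 ∧ x.nL = 0)
  | .three => x.uS ≤ l
  | .four => x.uS = 0

instance (k l : ℕ) (x : State) : Decidable (x.PhaseOver k l) := by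
  unfold State.PhaseOver
  split <;> infer_instance

/-- Passage to the next phase. -/
def State.advance (k : ℕ) (x : State) : State :=
  State.admit k { x with phase := x.phase.next }

/-- Arrival of a small job. -/
def State.arriveS (k : ℕ) (x : State) : State :=
  State.admit k { x with nS := x.nS + 1 }

/-- Arrival of a large job. -/
def State.arriveL (k : ℕ) (x : State) : State :=
  State.admit k { x with nL := x.nL + 1 }

/-- Completion of a small job in service. -/
def State.departS (k : ℕ) (x : State) : State :=
  State.admit k { x with nS := x.nS - 1, uS := x.uS - 1 }

/-- Completion of the large job in service. -/
def State.departL (k : ℕ) (x : State) : State :=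
  State.admit k { x with nL := x.nL - 1, uL := x.uL - 1 }

/-- Total event rate in a state: Poisson arrivals of rates `lamS`, `lamL`, and exponential services
of rate `muS` for each small and `muL` for each large job in service. -/
noncomputable def totalRate (lamS lamL muS muL : ℝ) (x : State) : ℝ :=
  lamS + lamL + x.uS * muS + x.uL * muL

/-- Holding law: if the phase is over, the next phase starts at once (a step of length zero);
otherwise the time to the next arrival or completion is exponential. -/
noncomputable def holdLaw (k l : ℕ) (lamS lamL muS muL : ℝ) (x : State) : Measure ℝ :=
  if x.PhaseOver k l then Measure.dirac 0 else expMeasure (totalRate lamS lamL muS muL x)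

/-- Step probabilities: a phase change if the phase is over, otherwise the next arrival or
completion, each kind of event with probability proportional to its rate. -/
noncomputable def stepProb (k l : ℕ) (lamS lamL muS muL : ℝ) (x y : State) : ENNReal :=
  if x.PhaseOver k l then (if y = x.advance k then 1 else 0)
  else ENNReal.ofReal
    (((if y = x.arriveS k then lamS else 0) + (if y = x.arriveL k then lamL else 0) +
      (if y = x.departS k then x.uS * muS else 0) +
      (if y = x.departL k then x.uL * muL else 0)) / totalRate lamS lamL muS muL x)

/-- `(X, T)` is a run of the one-or-all system with `k` servers under MSFQ with threshold `l`. -/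
def IsRun {Ω : Type*} [MeasurableSpace Ω] (k l : ℕ) (lamS lamL muS muL : ℝ) (P : Measure Ω)
    (X : ℕ → Ω → State) (T : ℕ → Ω → ℝ) : Prop :=
  IsJumpProcess (holdLaw k l lamS lamL muS muL) (stepProb k l lamS lamL muS muL) P X T

/-! ### Cycles and phases of a run

A cycle consists of phases 2, 3, 4, 1, in this order. -/

section Cycle

variable {Ω : Type*} (X : ℕ → Ω → State) (T : ℕ → Ω → ℝ)

/-- A phase 2 begins with step `n`. -/
def BeginsTwo (ω : Ω) (n : ℕ) : Prop :=
  0 < n ∧ (X (n - 1) ω).phase = .one ∧ (X n ω).phase = .two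

/-- Cycle number `c` (counted from `0`) begins with step `n`. -/
def CycleBegins (c : ℕ) (ω : Ω) (n : ℕ) : Prop :=
  BeginsTwo X ω n ∧ {m | m < n ∧ BeginsTwo X ω m}.ncard = c

/-- The event that cycle `c` takes place and that at least `k` small jobs are in the system at the
beginning of its phase 2. -/
def fullStart (k c : ℕ) : Set Ω :=
  {ω | ∃ n, CycleBegins X c ω n ∧ k ≤ (X n ω).nS}

/-- The first step, from step `m` on, at which the system is in phase `p`. -/
noncomputable def firstFrom (p : Phase) (m : ℕ) (ω : Ω) : ℕ :=
  sInf {n | m ≤ n ∧ (X n ω).phase = p}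

/-- Step at which phase 2 of cycle `c` begins. -/
noncomputable def start2 (c : ℕ) (ω : Ω) : ℕ := sInf {n | CycleBegins X c ω n}

/-- Step at which phase 3 of cycle `c` begins. -/
noncomputable def start3 (c : ℕ) (ω : Ω) : ℕ := firstFrom X .three (start2 X c ω) ω

/-- Step at which phase 4 of cycle `c` begins. -/
noncomputable def start4 (c : ℕ) (ω : Ω) : ℕ := firstFrom X .four (start3 X c ω) ω

/-- Step at which phase 1 of cycle `c` begins. -/
noncomputable def start1 (c : ℕ) (ω : Ω) : ℕ := firstFrom X .one (start4 X c ω) ω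

/-- Step at which phase 2 begins after phase 1 of cycle `c`. -/
noncomputable def start2' (c : ℕ) (ω : Ω) : ℕ := firstFrom X .two (start1 X c ω) ω

/-- All four phases of cycle `c` come to an end. -/
def CycleEnds (c : ℕ) (ω : Ω) : Prop :=
  ∃ n₂ n₃ n₄ n₁ n₂' : ℕ, CycleBegins X c ω n₂ ∧ n₂ ≤ n₃ ∧ n₃ ≤ n₄ ∧ n₄ ≤ n₁ ∧ n₁ ≤ n₂' ∧
    (X n₃ ω).phase = .three ∧ (X n₄ ω).phase = .four ∧ (X n₁ ω).phase = .one ∧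
    (X n₂' ω).phase = .two

/-- Duration of phase 2 of cycle `c`. -/
noncomputable def H2 (c : ℕ) (ω : Ω) : ℝ :=
  ∑ i ∈ Finset.Ico (start2 X c ω) (start3 X c ω), T i ω

/-- Duration of phase 3 of cycle `c`. -/
noncomputable def H3 (c : ℕ) (ω : Ω) : ℝ :=
  ∑ i ∈ Finset.Ico (start3 X c ω) (start4 X c ω), T i ω

/-- Duration of phase 4 of cycle `c`. -/
noncomputable def H4 (c : ℕ) (ω : Ω) : ℝ :=
  ∑ i ∈ Finset.Ico (start4 X c ω) (start1 X c ω), T i ω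

/-- Number of large jobs at the beginning of phase 1 of cycle `c`. -/
noncomputable def N1L (c : ℕ) (ω : Ω) : ℕ := (X (start1 X c ω) ω).nL

/-- Number of small jobs at the beginning of the phase 2 that follows phase 1 of cycle `c`. -/
noncomputable def N2S (c : ℕ) (ω : Ω) : ℕ := (X (start2' X c ω) ω).nS

end Cycle

/-! ### The busy period of large jobs -/

/-- Holding law of the number of jobs in an M/M/1 queue. -/
noncomputable def mm1Hold (lam mu : ℝ) (n : ℕ) : Measure ℝ :=
  expMeasure (if n = 0 then lam else lam + mu)

/-- Jump probabilities of the number of jobs in an M/M/1 queue. -/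
noncomputable def mm1Step (lam mu : ℝ) (n m : ℕ) : ENNReal :=
  if n = 0 then (if m = 1 then 1 else 0)
  else if m = n + 1 then ENNReal.ofReal (lam / (lam + mu))
  else if m + 1 = n then ENNReal.ofReal (mu / (lam + mu))
  else 0

/-- `(Y, U)` is the number-in-system process (states and holding times) of an M/M/1 queue with
arrival rate `lam` and service rate `mu` that starts with exactly one job. -/
def IsMM1FromOne {Ω : Type*} [MeasurableSpace Ω] (lam mu : ℝ) (Q : Measure Ω)
    (Y : ℕ → Ω → ℕ) (U : ℕ → Ω → ℝ) : Prop :=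
  IsJumpProcess (mm1Hold lam mu) (mm1Step lam mu) Q Y U ∧ ∀ᵐ ω ∂Q, Y 0 ω = 1

/-- The busy period: the time until the queue is empty. -/
noncomputable def busyPeriod {Ω : Type*} (Y : ℕ → Ω → ℕ) (U : ℕ → Ω → ℝ) (ω : Ω) : ℝ :=
  ∑ i ∈ Finset.range (sInf {n | Y n ω = 0}), U i ω

/-! ### Transforms -/

/-- Laplace–Stieltjes transform `E[exp (-s H)]`. -/
noncomputable def lst {Ω : Type*} [MeasurableSpace Ω] (P : Measure Ω) (H : Ω → ℝ) (s : ℂ) : ℂ :=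
  ∫ ω, Complex.exp (-s * (H ω : ℂ)) ∂P

/-- z-transform `E[z ^ N]`. -/
noncomputable def zTransform {Ω : Type*} [MeasurableSpace Ω] (P : Measure Ω) (N : Ω → ℕ)
    (z : ℂ) : ℂ :=
  ∫ ω, z ^ N ω ∂P

end MSFQ

/-! A full start makes the levels at the phase changes deterministic. Small jobs leave one at a
time, so phase 2 ends with exactly `k - 1` of them in the system and phase 3 with exactly `l`, all
in service. Hence phases 3 and 4 always start from the same small-job levels. At the beginning of
phase 1 the large jobs are the arrivals of phases 2, 3, 4, and the small jobs are the arrivals of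
phase 4 alone. Weighting each arrival of a Poisson stream of rate `a` by `y` has the same effect as
discounting time at rate `a * (1 - y)`. The joint transform of the three durations and the two
counts therefore has the form `A (s₂ + lamL * (1 - y)) * B (s₃ + lamL * (1 - y)) * C (s₄ + lamL * (1
- y) + lamS * (1 - v))`, which is `IsRun.exists_cycle_transform`. Specializing the parameters gives
each single transform, and the normalization `A 0 * B 0 * C 0 = 1` turns the factorization into the
product formula.

The factorization is proved without splitting Poisson processes. The function `serviceFun` is an
explicit bounded function on states, harmonic for the chain discounted at a rate depending on the
phase (`serviceFun_harmonic`, `serviceFun_advance`); `integral_optional_stopping` at the entrance to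
phase 1 then evaluates the transform.

Phase 1 is treated in the same way with the function `r ^ nL * z ^ nS`, where `r` is a root in the
closed unit disc of the busy-period quadratic with discount `lamS * (1 - z)`. Optional stopping for
the M/M/1 queue identifies every such root with the busy-period transform, so `β z = r` and the
second identity is the factorization at `y = r`, `v = z`.

Optional stopping needs the target to be reached almost surely. This follows from Foster's
criterion; stability enters only through `lamS < k * muS` and `lamL < muL`. The strong Markov
property `IsJumpProcess.shift` restarts the run at the beginning of phase 2 and again at the
beginning of phase 1. -/

namespace MSFQ

open Filter Topology

/-! ### Path cylinders and events determined by finitely many states -/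

section General

variable {S Ω : Type*} {X : ℕ → Ω → S}

/-- The event that the path follows `x` up to step `n`. -/
def cyl (X : ℕ → Ω → S) (n : ℕ) (x : ℕ → S) : Set Ω := {ω | ∀ i ≤ n, X i ω = x i}

/-- The event `E` depends only on the states visited up to step `n`. -/
def DependsOn (X : ℕ → Ω → S) (n : ℕ) (E : Set Ω) : Prop :=
  ∀ ω ω', (∀ i ≤ n, X i ω = X i ω') → ω ∈ E → ω' ∈ E

/-- The infinite path that extends a finite one by its last state. -/
def extendPath {n : ℕ} (p : Fin (n + 1) → S) (i : ℕ) : S := p ⟨min i n, by omega⟩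

lemma cyl_extendPath (n : ℕ) (p : Fin (n + 1) → S) :
    cyl X n (extendPath p) = (fun ω (i : Fin (n + 1)) => X i ω) ⁻¹' {p} := by
  ext ω
  simp only [cyl, extendPath, Set.mem_ofPred_eq, Set.mem_preimage, Set.mem_singleton_iff]
  constructor
  · intro h
    funext i
    have := h i (by omega)
    rw [this]
    congr 1
    ext
    simp
    omega
  · rintro rfl i hi
    simp [hi]

lemma iUnion_cyl_extendPath (n : ℕ) :
    ⋃ p : Fin (n + 1) → S, cyl X n (extendPath p) = Set.univ := by
  simp_rw [cyl_extendPath]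
  ext ω
  simp

lemma pairwise_disjoint_cyl_extendPath (n : ℕ) :
    Pairwise (Function.onFun Disjoint fun p : Fin (n + 1) → S => cyl X n (extendPath p)) := by
  intro p q hpq
  simp only [Function.onFun, cyl_extendPath]
  exact Disjoint.preimage _ (by simpa using hpq)

/-- Such an event is thus a union of cylinders, and for countable `S` there are only countably many
of each length. All later measurability and conditioning arguments reduce to cylinders in this way.
-/
lemma DependsOn.inter_cyl {n : ℕ} {E : Set Ω} (hE : DependsOn X n E) (x : ℕ → S) :
    E ∩ cyl X n x = ∅ ∨ E ∩ cyl X n x = cyl X n x := by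
  rcases (E ∩ cyl X n x).eq_empty_or_nonempty with h | ⟨ω, h1, h2⟩
  · exact Or.inl h
  · refine Or.inr (Set.inter_eq_right.2 fun ω' h' => hE ω ω' (fun i hi => ?_) h1)
    rw [h2 i hi, h' i hi]

/-! ### Laws given a finite path, the strong Markov property, Foster's criterion -/

namespace IsJumpProcess

variable [MeasurableSpace Ω] {hold : S → Measure ℝ} {jump : S → S → ENNReal} {P : Measure Ω}
  {T : ℕ → Ω → ℝ}

lemma measurableSet_cyl (h : IsJumpProcess hold jump P X T) (n : ℕ) (x : ℕ → S) :
    MeasurableSet (cyl X n x) := by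
  have : cyl X n x = ⋂ i, ⋂ (_ : i ≤ n), {ω | X i ω = x i} := by
    ext; simp [cyl]
  rw [this]
  exact MeasurableSet.iInter fun i => MeasurableSet.iInter fun _ => h.measurable_state i _

lemma measurable_comp (h : IsJumpProcess hold jump P X T) [Countable S] {β : Type*}
    [MeasurableSpace β] (n : ℕ) (f : S → β) : Measurable fun ω => f (X n ω) := by
  let _ : MeasurableSpace S := ⊤
  exact (measurable_from_top (f := f)).comp (measurable_to_countable' fun x => h.measurable_state n x)

lemma measurable_weight (h : IsJumpProcess hold jump P X T) [Countable S] {β : Type*}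
    [MeasurableSpace β] (n : ℕ) {w : S → ℝ → β} (hw : ∀ x, Measurable (w x)) :
    Measurable fun ω => w (X n ω) (T n ω) := by
  let _ : MeasurableSpace S := ⊤
  have h1 : Measurable (Function.uncurry w) := measurable_from_prod_countable_right hw
  have h2 : Measurable fun ω => (X n ω, T n ω) :=
    (measurable_to_countable' fun x => h.measurable_state n x).prodMk (h.measurable_time n)
  exact h1.comp h2

lemma measurableSet_state (h : IsJumpProcess hold jump P X T) [Countable S] (n : ℕ) (A : Set S) :
    MeasurableSet {ω | X n ω ∈ A} := by
  let _ : MeasurableSpace S := ⊤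
  exact (measurable_to_countable' fun x => h.measurable_state n x) (MeasurableSet.of_discrete (s := A))

lemma measurableSet_dependsOn (h : IsJumpProcess hold jump P X T) [Countable S] {n : ℕ}
    {E : Set Ω} (hE : DependsOn X n E) : MeasurableSet E := by
  have : E = ⋃ p : Fin (n + 1) → S, E ∩ cyl X n (extendPath p) := by
    rw [← Set.inter_iUnion, iUnion_cyl_extendPath, Set.inter_univ]
  rw [this]
  refine MeasurableSet.iUnion fun p => ?_
  rcases hE.inter_cyl (extendPath p) with h' | h' <;> rw [h']
  · exact MeasurableSet.empty
  · exact h.measurableSet_cyl _ _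

lemma measure_eq_tsum_cyl (h : IsJumpProcess hold jump P X T) [Countable S] (n : ℕ)
    {E : Set Ω} (hE : MeasurableSet E) :
    P E = ∑' p : Fin (n + 1) → S, P (E ∩ cyl X n (extendPath p)) := by
  rw [← measure_iUnion, ← Set.inter_iUnion, iUnion_cyl_extendPath, Set.inter_univ]
  · exact fun p q hpq => (pairwise_disjoint_cyl_extendPath n hpq).mono Set.inter_subset_right
      Set.inter_subset_right
  · exact fun p => hE.inter (h.measurableSet_cyl _ _)

lemma ae_of_cyl (_h : IsJumpProcess hold jump P X T) [Countable S] (n : ℕ) {E : Set Ω}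
    (hE : ∀ x, P (E ∩ cyl X n x) = 0) : P E = 0 := by
  have : E = ⋃ p : Fin (n + 1) → S, E ∩ cyl X n (extendPath p) := by
    rw [← Set.inter_iUnion, iUnion_cyl_extendPath, Set.inter_univ]
  rw [this]
  exact measure_iUnion_null fun p => hE _

lemma integral_eq_zero_of_cyl (h : IsJumpProcess hold jump P X T) [Countable S] (n : ℕ)
    {g : Ω → ℂ} (hg : Integrable g P) (h0 : ∀ x, ∫ ω in cyl X n x, g ω ∂P = 0) :
    ∫ ω, g ω ∂P = 0 := by
  have := hasSum_integral_iUnion (f := g) (μ := P)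
    (fun p : Fin (n + 1) → S => h.measurableSet_cyl n (extendPath p))
    (pairwise_disjoint_cyl_extendPath n) hg.integrableOn
  rw [iUnion_cyl_extendPath, setIntegral_univ] at this
  simp only [h0] at this
  exact this.unique hasSum_zero

variable [∀ x, IsProbabilityMeasure (hold x)]

lemma measure_cyl (h : IsJumpProcess hold jump P X T) (n : ℕ) (x : ℕ → S) :
    P (cyl X n x) = P {ω | X 0 ω = x 0} * ∏ i ∈ Finset.range n, jump (x i) (x (i + 1)) := by
  simpa [cyl] using h.law n x (fun _ => Set.univ) (fun _ => MeasurableSet.univ)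

lemma measure_cyl_succ (h : IsJumpProcess hold jump P X T) (n : ℕ) (x : ℕ → S) :
    P (cyl X (n + 1) x) = P (cyl X n x) * jump (x n) (x (n + 1)) := by
  rw [h.measure_cyl, h.measure_cyl, Finset.prod_range_succ, mul_assoc]

/-- Given the path up to step `n`, the sojourn times are independent with laws `hold (x i)`. -/
lemma map_times_cyl (h : IsJumpProcess hold jump P X T) [IsFiniteMeasure P] (n : ℕ) (x : ℕ → S) :
    (P.restrict (cyl X n x)).map (fun ω (i : Fin n) => T i ω) =
      P (cyl X n x) • Measure.pi fun i : Fin n => hold (x i) := by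
  have hm : Measurable (fun ω (i : Fin n) => T i ω) :=
    measurable_pi_lambda _ fun i => h.measurable_time i
  have key : ∀ B : Fin n → Set ℝ, (∀ i, MeasurableSet (B i)) →
      (P.restrict (cyl X n x)).map (fun ω (i : Fin n) => T i ω) (Set.univ.pi B) =
      (P (cyl X n x) • Measure.pi fun i : Fin n => hold (x i)) (Set.univ.pi B) := by
    intro B hB
    have hB' : MeasurableSet (Set.univ.pi B) := MeasurableSet.univ_pi hB
    rw [Measure.map_apply hm hB', Measure.restrict_apply (hm hB'), Measure.smul_apply,
      Measure.pi_pi, smul_eq_mul, h.measure_cyl]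
    have := h.law n x (fun i => if hi : i < n then B ⟨i, hi⟩ else Set.univ)
      (fun i => by split_ifs; exacts [hB _, MeasurableSet.univ])
    rw [Finset.prod_mul_distrib, ← Fin.prod_univ_eq_prod_range
      (fun i => (hold (x i)) (if hi : i < n then B ⟨i, hi⟩ else Set.univ))] at this
    simp only [Fin.is_lt, dif_pos, Fin.eta] at this
    rw [mul_assoc, mul_comm (∏ i ∈ Finset.range n, _), ← this]
    congr 1
    ext ω
    simp only [Set.mem_inter_iff, Set.mem_preimage, Set.mem_univ_pi, cyl, Set.mem_ofPred_eq]
    rw [and_comm]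
    refine and_congr_right fun _ => ⟨fun h' i hi => ?_, fun h' i => ?_⟩
    · simpa [hi] using h' ⟨i, hi⟩
    · simpa using h' i i.2
  refine ext_of_generate_finite _ (generateFrom_pi (ι := Fin n) (α := fun _ => ℝ)).symm
    isPiSystem_pi ?_ ?_
  · rintro _ ⟨B, hB, rfl⟩
    exact key B fun i => hB i (Set.mem_univ i)
  · have := key (fun _ => Set.univ) (fun _ => MeasurableSet.univ)
    simpa [Set.pi_univ] using this

lemma setIntegral_cyl_prod (h : IsJumpProcess hold jump P X T) [IsFiniteMeasure P] (n : ℕ)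
    (x : ℕ → S) {w : S → ℝ → ℂ} (hw : ∀ x, Measurable (w x)) :
    ∫ ω in cyl X n x, ∏ i ∈ Finset.range n, w (x i) (T i ω) ∂P =
      (P (cyl X n x)).toReal * ∏ i ∈ Finset.range n, ∫ t, w (x i) t ∂hold (x i) := by
  have hm : Measurable (fun ω (i : Fin n) => T i ω) :=
    measurable_pi_lambda _ fun i => h.measurable_time i
  have hg : Measurable fun t : Fin n → ℝ => ∏ i : Fin n, w (x i) (t i) :=
    Finset.measurable_prod _ fun i _ => (hw _).comp (measurable_pi_apply i)
  have := integral_map (μ := P.restrict (cyl X n x)) hm.aemeasurable hg.aestronglyMeasurable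
  rw [h.map_times_cyl, integral_smul_measure,
    integral_fintype_prod_eq_prod (fun (i : Fin n) t => w (x i) t)] at this
  rw [← Fin.prod_univ_eq_prod_range (fun i => ∫ t, w (x i) t ∂hold (x i))]
  simp_rw [← Fin.prod_univ_eq_prod_range (fun i => w (x i) (T i _))]
  rw [← this]
  simp

lemma ae_step (h : IsJumpProcess hold jump P X T) [Countable S] {Q : S → ℝ → Prop}
    (hQ : ∀ x, ∀ᵐ t ∂hold x, Q x t) :
    ∀ᵐ ω ∂P, ∀ n, jump (X n ω) (X (n + 1) ω) ≠ 0 ∧ Q (X n ω) (T n ω) := by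
  rw [ae_all_iff]
  intro n
  rw [ae_iff]
  refine h.ae_of_cyl (n + 1) fun x => ?_
  by_cases hj : jump (x n) (x (n + 1)) = 0
  · refine measure_mono_null Set.inter_subset_right ?_
    rw [h.measure_cyl_succ, hj, mul_zero]
  -- The exceptional set need not be measurable, whereas `law` takes measurable sets only; a
  -- measurable null superset replaces it in coordinate `n`.
  · obtain ⟨N, hN, hNm, hN0⟩ := exists_measurable_superset_of_null (ae_iff.1 (hQ (x n)))
    have hl := h.law (n + 1) x (fun i => if i = n then N else Set.univ)
      (fun i => by split_ifs; exacts [hNm, MeasurableSet.univ])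
    rw [Finset.prod_range_succ] at hl
    simp only [if_true, hN0, zero_mul, mul_zero] at hl
    refine measure_mono_null ?_ hl
    rintro ω ⟨h1, h2⟩
    refine ⟨h2, fun i hi => ?_⟩
    split_ifs with hin
    · subst hin
      apply hN
      have e1 := h2 i (by omega)
      have e2 := h2 (i + 1) (by omega)
      simp only [Set.mem_ofPred_eq, e1, e2] at h1 ⊢
      tauto
    · trivial

/-- Markov property at a fixed step. On each cylinder of the past, a prescribed future is again a
prescribed path, namely the concatenation of the two, so `law` applies and its product splits at
`n`. -/
lemma shift_law (h : IsJumpProcess hold jump P X T) [Countable S] {n : ℕ} {E : Set Ω}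
    (hE : DependsOn X n E) (m : ℕ) (x : ℕ → S) (B : ℕ → Set ℝ) (hB : ∀ i, MeasurableSet (B i)) :
    P (E ∩ {ω | (∀ i ≤ m, X (n + i) ω = x i) ∧ ∀ i < m, T (n + i) ω ∈ B i}) =
      P (E ∩ {ω | X n ω = x 0}) *
        ∏ i ∈ Finset.range m, (hold (x i) (B i) * jump (x i) (x (i + 1))) := by
  have hEm := h.measurableSet_dependsOn hE
  have hAm : MeasurableSet {ω | (∀ i ≤ m, X (n + i) ω = x i) ∧ ∀ i < m, T (n + i) ω ∈ B i} := by
    simp only [Set.ofPred_and, Set.ofPred_forall]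
    refine (MeasurableSet.iInter fun i => MeasurableSet.iInter fun _ => h.measurable_state _ _).inter
      (MeasurableSet.iInter fun i => MeasurableSet.iInter fun _ => h.measurable_time _ (hB i))
  rw [h.measure_eq_tsum_cyl n (hEm.inter hAm),
    h.measure_eq_tsum_cyl n (hEm.inter (h.measurable_state n (x 0))), ← ENNReal.tsum_mul_right]
  congr 1
  funext p
  rw [Set.inter_right_comm, Set.inter_right_comm E {ω | X n ω = x 0}]
  generalize hq : extendPath p = q
  rcases hE.inter_cyl q with he | he <;> rw [he]
  · simp
  by_cases hx : q n = x 0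
  · have e1 : cyl X n q ∩ {ω | X n ω = x 0} = cyl X n q :=
      Set.inter_eq_left.2 fun ω hω => by
        simp only [Set.mem_ofPred_eq]
        rw [hω n le_rfl, hx]
    let y : ℕ → S := fun i => if i ≤ n then q i else x (i - n)
    have hy : ∀ i, y (n + i) = x i := by
      intro i
      by_cases hi : i = 0
      · subst hi; simp [y, hx]
      · simp [y, hi]
    have e2 : cyl X n q ∩ {ω | (∀ i ≤ m, X (n + i) ω = x i) ∧ ∀ i < m, T (n + i) ω ∈ B i} =
        {ω | (∀ i ≤ n + m, X i ω = y i) ∧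
          ∀ i < n + m, T i ω ∈ (if i < n then Set.univ else B (i - n))} := by
      ext ω
      constructor
      · rintro ⟨h1, h2, h3⟩
        refine ⟨fun i hi => ?_, fun i hi => ?_⟩
        · by_cases hin : i ≤ n
          · simp [y, hin, h1 i hin]
          · have := h2 (i - n) (by omega)
            rw [show n + (i - n) = i by omega] at this
            simp [y, hin, this]
        · split_ifs with hin
          · trivial
          · have := h3 (i - n) (by omega)
            rwa [show n + (i - n) = i by omega] at this
      · rintro ⟨h1, h2⟩
        refine ⟨fun i hi => ?_, fun i hi => ?_, fun i hi => ?_⟩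
        · simpa [y, hi] using h1 i (by omega)
        · rw [← hy]; exact h1 _ (by omega)
        · simpa using h2 (n + i) (by omega)
    rw [e1, e2, h.law (n + m) y _ (fun i => by split_ifs; exacts [MeasurableSet.univ, hB _]),
      h.measure_cyl, Finset.prod_range_add, ← mul_assoc]
    congr 1
    · congr 1
      refine Finset.prod_congr rfl fun i hi => ?_
      have : i < n := Finset.mem_range.1 hi
      have h2 : i ≤ n := by omega
      simp [y, this, h2]
    · refine Finset.prod_congr rfl fun i hi => ?_
      rw [hy, add_assoc, hy]
      simp
  · have e1 : cyl X n q ∩ {ω | X n ω = x 0} = ∅ := by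
      ext ω
      simp only [Set.mem_inter_iff, Set.mem_ofPred_eq, Set.mem_empty_iff_false, iff_false]
      rintro ⟨h1, h2⟩
      exact hx (by rw [← h2, h1 n le_rfl])
    have e2 : cyl X n q ∩ {ω | (∀ i ≤ m, X (n + i) ω = x i) ∧ ∀ i < m, T (n + i) ω ∈ B i} = ∅ := by
      rw [← Set.subset_empty_iff, ← e1]
      exact fun ω hω => ⟨hω.1, hω.2.1 0 (by omega)⟩
    rw [e1, e2]; simp

/-- Strong Markov property at the random step `N`, on the event `F`. -/
theorem shift (h : IsJumpProcess hold jump P X T) [Countable S] {F : Set Ω} {N : Ω → ℕ}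
    (hdet : ∀ n, DependsOn X n (F ∩ {ω | N ω = n})) (hN : ∀ ω ∉ F, N ω = 0) :
    MeasurableSet F ∧ IsJumpProcess hold jump (P.restrict F) (fun i ω => X (N ω + i) ω)
      (fun i ω => T (N ω + i) ω) := by
  have hFn : ∀ n, MeasurableSet (F ∩ {ω | N ω = n}) := fun n => h.measurableSet_dependsOn (hdet n)
  have hFU : F = ⋃ n, F ∩ {ω | N ω = n} := by
    rw [← Set.inter_iUnion]
    ext ω; simp
  have hF : MeasurableSet F := by rw [hFU]; exact MeasurableSet.iUnion hFn
  -- The hypotheses control `N` only on `F`; the default value `0` off `F` makes its level sets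
  -- measurable everywhere.
  have hNm : ∀ n, MeasurableSet {ω | N ω = n} := by
    intro n
    have : {ω | N ω = n} = (F ∩ {ω | N ω = n}) ∪ (Fᶜ ∩ {_ω | n = 0}) := by
      ext ω
      by_cases hω : ω ∈ F
      · simp [hω]
      · simp [hω, hN ω hω, eq_comm]
    rw [this]
    exact (hFn n).union (hF.compl.inter (MeasurableSet.const _))
  have hunion : ∀ C : Ω → Prop, {ω | C ω} = ⋃ n, {ω | N ω = n} ∩ {ω | C ω} := by
    intro C; ext ω; simp
  refine ⟨hF, ?_, ?_, ?_⟩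
  · intro i x
    rw [hunion]
    refine MeasurableSet.iUnion fun n => ?_
    have : {ω | N ω = n} ∩ {ω | X (N ω + i) ω = x} = {ω | N ω = n} ∩ {ω | X (n + i) ω = x} := by
      ext ω; simp only [Set.mem_inter_iff, Set.mem_ofPred_eq]
      exact and_congr_right fun e => by rw [e]
    rw [this]
    exact (hNm n).inter (h.measurable_state _ _)
  · intro i B hB
    change MeasurableSet {ω | T (N ω + i) ω ∈ B}
    rw [hunion]
    refine MeasurableSet.iUnion fun n => ?_
    have : {ω | N ω = n} ∩ {ω | T (N ω + i) ω ∈ B} = {ω | N ω = n} ∩ {ω | T (n + i) ω ∈ B} := by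
      ext ω; simp only [Set.mem_inter_iff, Set.mem_ofPred_eq]
      exact and_congr_right fun e => by rw [e]
    rw [this]
    exact (hNm n).inter (h.measurable_time _ hB)
  · intro m x B hB
    rw [Measure.restrict_apply' hF, Measure.restrict_apply' hF, Set.inter_comm, Set.inter_comm _ F]
    have split : ∀ (C : Ω → Prop) (D : ℕ → Set Ω), (∀ n, MeasurableSet (D n)) →
        (∀ n ω, N ω = n → (C ω ↔ ω ∈ D n)) →
        P (F ∩ {ω | C ω}) = ∑' n, P ((F ∩ {ω | N ω = n}) ∩ D n) := by
      intro C D hD hCD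
      rw [← measure_iUnion]
      · congr 1
        ext ω
        simp only [Set.mem_inter_iff, Set.mem_ofPred_eq, Set.mem_iUnion]
        constructor
        · rintro ⟨h1, h2⟩
          exact ⟨N ω, ⟨h1, rfl⟩, (hCD _ ω rfl).1 h2⟩
        · rintro ⟨n, ⟨h1, h2⟩, h3⟩
          exact ⟨h1, (hCD n ω h2).2 h3⟩
      · intro i j hij
        rw [Function.onFun, Set.disjoint_left]
        rintro ω ⟨⟨_, h1⟩, _⟩ ⟨⟨_, h2⟩, _⟩
        exact hij (h1.symm.trans h2)
      · exact fun n => (hFn n).inter (hD n)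
    rw [split _ (fun n => {ω | (∀ i ≤ m, X (n + i) ω = x i) ∧ ∀ i < m, T (n + i) ω ∈ B i}),
      split _ (fun n => {ω | X n ω = x 0}), ← ENNReal.tsum_mul_right]
    · congr 1
      funext n
      exact h.shift_law (hdet n) m x B hB
    · exact fun n => h.measurable_state _ _
    · intro n ω e; simp [e]
    · intro n
      simp only [Set.ofPred_and, Set.ofPred_forall]
      exact (MeasurableSet.iInter fun i => MeasurableSet.iInter fun _ =>
        h.measurable_state _ _).inter
        (MeasurableSet.iInter fun i => MeasurableSet.iInter fun _ => h.measurable_time _ (hB i))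
    · intro n ω e; simp [e]

lemma setLIntegral_succ (h : IsJumpProcess hold jump P X T) [Countable S] {n : ℕ} {E : Set Ω}
    (hE : DependsOn X n E) (V : S → ENNReal) :
    ∫⁻ ω in E, V (X (n + 1) ω) ∂P = ∫⁻ ω in E, ∑' y, jump (X n ω) y * V y ∂P := by
  have hEm := h.measurableSet_dependsOn hE
  have base : ∀ (m : ℕ) (g : S → ENNReal),
      ∫⁻ ω in E, g (X m ω) ∂P = ∑' y, g y * P (E ∩ {ω | X m ω = y}) := by
    intro m g
    let _ : MeasurableSpace S := ⊤
    have hm : Measurable (X m) := measurable_to_countable' fun x => h.measurable_state m x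
    rw [← lintegral_map (μ := P.restrict E) (f := g) measurable_from_top hm, lintegral_countable']
    congr 1; funext y
    rw [Measure.map_apply hm (MeasurableSet.singleton y),
      Measure.restrict_apply (hm (MeasurableSet.singleton y)), Set.inter_comm]
    rfl
  have hstep : ∀ x y, P (E ∩ {ω | X n ω = x} ∩ {ω | X (n + 1) ω = y}) =
      P (E ∩ {ω | X n ω = x}) * jump x y := by
    intro x y
    have := h.shift_law hE 1 (fun i => if i = 0 then x else y) (fun _ => Set.univ)
      (fun _ => MeasurableSet.univ)
    simp only [if_true, Finset.range_one, Finset.prod_singleton, measure_univ, one_mul,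
      zero_add, one_ne_zero, if_false] at this
    rw [← this, Set.inter_assoc]
    congr 2
    ext ω
    simp only [Set.mem_inter_iff, Set.mem_ofPred_eq, Set.mem_univ, implies_true, and_true]
    constructor
    · rintro ⟨h1, h2⟩ i hi
      interval_cases i <;> simpa
    · intro h'
      exact ⟨by simpa using h' 0 (by omega), by simpa using h' 1 le_rfl⟩
  rw [base, base n (fun x => ∑' y, jump x y * V y)]
  have : ∀ y, P (E ∩ {ω | X (n + 1) ω = y}) = ∑' x, P (E ∩ {ω | X n ω = x}) * jump x y := by
    intro y
    simp_rw [← hstep]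
    rw [← measure_iUnion]
    · congr 1
      ext ω; simp
    · intro i j hij
      rw [Function.onFun, Set.disjoint_left]
      rintro ω ⟨⟨_, h1⟩, _⟩ ⟨⟨_, h2⟩, _⟩
      exact hij (h1.symm.trans h2)
    · exact fun x => (hEm.inter (h.measurable_state _ _)).inter (h.measurable_state _ _)
  simp_rw [this, ← ENNReal.tsum_mul_left, ← ENNReal.tsum_mul_right]
  rw [ENNReal.tsum_comm]
  congr 1; funext x; congr 1; funext y
  ring

/-- Foster's criterion: a nonnegative function with drift at most `-1` outside `A` forces a visit
to `A`. -/
theorem ae_exists_mem (h : IsJumpProcess hold jump P X T) [Countable S] [IsFiniteMeasure P]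
    {A : Set S} {V : S → ENNReal} (hV : ∀ x ∉ A, ∑' y, jump x y * V y + 1 ≤ V x)
    (h0 : ∀ᵐ ω ∂P, V (X 0 ω) ≠ ⊤) : ∀ᵐ ω ∂P, ∃ n, X n ω ∈ A := by
  -- The initial law is arbitrary, so `V (X 0)` may fail to be integrable. Fixing the starting state
  -- gives a finite initial expectation, and countably many starting states suffice.
  have key : ∀ x, V x ≠ ⊤ → P {ω | X 0 ω = x ∧ ∀ n, X n ω ∉ A} = 0 := by
    intro x hx
    let G : ℕ → Set Ω := fun n => {ω | X 0 ω = x ∧ ∀ i ≤ n, X i ω ∉ A}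
    have hG : ∀ n, DependsOn X n (G n) := by
      rintro n ω ω' he ⟨h1, h2⟩
      exact ⟨by rw [← he 0 (by omega), h1], fun i hi => by rw [← he i hi]; exact h2 i hi⟩
    have hGm : ∀ n, MeasurableSet (G n) := fun n => h.measurableSet_dependsOn (hG n)
    have hmono : ∀ n, G (n + 1) ⊆ G n := fun n ω hω => ⟨hω.1, fun i hi => hω.2 i (by omega)⟩
    let a : ℕ → ENNReal := fun n => ∫⁻ ω in G n, V (X n ω) ∂P
    -- Each step spent outside `A` costs at least one unit of expected `V`. Summing, the survival
    -- probabilities `P (G n)` have a sum bounded by `a 0`, so they tend to zero.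
    have ha : ∀ n, a (n + 1) + P (G n) ≤ a n := by
      intro n
      calc a (n + 1) + P (G n) ≤ ∫⁻ ω in G n, V (X (n + 1) ω) ∂P + P (G n) := by
            gcongr; exact lintegral_mono_set (hmono n)
        _ = ∫⁻ ω in G n, (∑' y, jump (X n ω) y * V y + 1) ∂P := by
            rw [h.setLIntegral_succ (hG n), lintegral_add_right _ measurable_const]
            simp
        _ ≤ a n := by
            refine setLIntegral_mono' (hGm n) fun ω hω => hV _ (hω.2 n le_rfl)
    have hsum : ∀ n, a n + ∑ i ∈ Finset.range n, P (G i) ≤ a 0 := by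
      intro n
      induction n with
      | zero => simp
      | succ n ih =>
        rw [Finset.sum_range_succ, add_comm (∑ i ∈ Finset.range n, P (G i)), ← add_assoc]
        exact (add_le_add_left (ha n) _).trans ih
    have ha0 : a 0 ≠ ⊤ := by
      have : a 0 ≤ V x * P Set.univ := by
        calc a 0 ≤ ∫⁻ ω in G 0, V x ∂P :=
              setLIntegral_mono' (hGm 0) fun ω hω => by rw [hω.1]
          _ ≤ V x * P Set.univ := by
              rw [setLIntegral_const]; gcongr; exact Set.subset_univ _
      exact ne_top_of_le_ne_top (ENNReal.mul_ne_top hx (measure_ne_top _ _)) this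
    have hfin : ∑' i, P (G i) ≠ ⊤ := by
      refine ne_top_of_le_ne_top ha0 ?_
      rw [ENNReal.tsum_eq_iSup_nat]
      exact iSup_le fun n => le_add_self.trans (hsum n)
    have ht := ENNReal.tendsto_atTop_zero_of_tsum_ne_top hfin
    have hle : ∀ n, P {ω | X 0 ω = x ∧ ∀ n, X n ω ∉ A} ≤ P (G n) := fun n =>
      measure_mono fun ω hω => ⟨hω.1, fun i _ => hω.2 i⟩
    exact le_antisymm (ge_of_tendsto' ht hle) bot_le
  have : ∀ᵐ ω ∂P, ∀ x, V x ≠ ⊤ → ¬ (X 0 ω = x ∧ ∀ n, X n ω ∉ A) := by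
    rw [ae_all_iff]
    intro x
    by_cases hx : V x = ⊤
    · simp [hx]
    · filter_upwards [measure_eq_zero_iff_ae_notMem.1 (key x hx)] with ω hω _ using hω
  filter_upwards [this, h0] with ω h1 h2
  by_contra! h3
  exact h1 _ h2 ⟨rfl, h3⟩

end IsJumpProcess

end General

/-! ### Optional stopping for the discounted process -/

namespace IsJumpProcess

variable {S Ω : Type*} [MeasurableSpace Ω] {hold : S → Measure ℝ} {jump : S → S → ENNReal}
  {P : Measure Ω} {X : ℕ → Ω → S} {T : ℕ → Ω → ℝ}

/-- Increments of the discounted process stopped on reaching `A`. -/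
noncomputable def stoppedIncrement (X : ℕ → Ω → S) (T : ℕ → Ω → ℝ) (A : Set S) (w : S → ℝ → ℂ)
    (f : S → ℂ) (n : ℕ) (ω : Ω) : ℂ :=
  open Classical in
  if ∀ i ≤ n, X i ω ∉ A then
    (∏ i ∈ Finset.range n, w (X i ω) (T i ω)) * (w (X n ω) (T n ω) * f (X (n + 1) ω) - f (X n ω))
  else 0

lemma measurable_prod_weight (h : IsJumpProcess hold jump P X T) [Countable S]
    {w : S → ℝ → ℂ} (hw : ∀ x, Measurable (w x)) (n : ℕ) :
    Measurable fun ω => ∏ i ∈ Finset.range n, w (X i ω) (T i ω) :=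
  Finset.measurable_prod _ fun i _ => h.measurable_weight i hw

omit [MeasurableSpace Ω] in
lemma norm_prod_weight_le {w : S → ℝ → ℂ} {ω : Ω} (hω : ∀ n, ‖w (X n ω) (T n ω)‖ ≤ 1) (n : ℕ) :
    ‖∏ i ∈ Finset.range n, w (X i ω) (T i ω)‖ ≤ 1 := by
  rw [norm_prod]
  exact Finset.prod_le_one (fun _ _ => norm_nonneg _) fun i _ => hω i

omit [MeasurableSpace Ω] in
-- The increments telescope up to `τ` and vanish from `τ` on, which identifies their partial sums
-- with the discounted process stopped at `τ`.
lemma sum_stoppedIncrement (A : Set S) (w : S → ℝ → ℂ) (f : S → ℂ) {ω : Ω} {τ : ℕ}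
    (hτ : X τ ω ∈ A) (hlt : ∀ i < τ, X i ω ∉ A) (n : ℕ) :
    f (X 0 ω) + ∑ i ∈ Finset.range n, stoppedIncrement X T A w f i ω =
      (∏ i ∈ Finset.range (min n τ), w (X i ω) (T i ω)) * f (X (min n τ) ω) := by
  induction n with
  | zero => simp
  | succ n ih =>
    rw [Finset.sum_range_succ, ← add_assoc, ih]
    by_cases hn : n < τ
    · rw [min_eq_left hn.le, min_eq_left (show n + 1 ≤ τ from hn), stoppedIncrement,
        if_pos (fun i hi => hlt i (by omega)), Finset.prod_range_succ]
      ring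
    · rw [min_eq_right (by omega), min_eq_right (by omega), stoppedIncrement, if_neg, add_zero]
      push Not
      exact ⟨τ, by omega, hτ⟩

variable [∀ x, IsProbabilityMeasure (hold x)]

/-- An invariant of the possible transitions outside `A` holds until `A` is reached. -/
lemma ae_mem_of_invariant (h : IsJumpProcess hold jump P X T) [Countable S] {A R : Set S}
    (hR : ∀ x ∈ R, x ∉ A → ∀ y, jump x y ≠ 0 → y ∈ R) (h0 : ∀ᵐ ω ∂P, X 0 ω ∈ R) :
    ∀ᵐ ω ∂P, ∀ n, (∀ i < n, X i ω ∉ A) → X n ω ∈ R := by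
  filter_upwards [h.ae_step (Q := fun _ _ => True) (fun _ => by simp), h0] with ω h1 h2 n
  induction n with
  | zero => exact fun _ => h2
  | succ n ih => exact fun hn => hR _ (ih fun i hi => hn i (by omega)) (hn n (by omega)) _ (h1 n).1

omit [∀ x, IsProbabilityMeasure (hold x)] in
lemma measurable_stoppedIncrement (h : IsJumpProcess hold jump P X T) [Countable S] {A : Set S}
    {w : S → ℝ → ℂ} (hw : ∀ x, Measurable (w x)) (f : S → ℂ) (n : ℕ) :
    Measurable (stoppedIncrement X T A w f n) := by
  unfold stoppedIncrement
  refine Measurable.ite ?_ ?_ measurable_const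
  · simp only [Set.ofPred_forall]
    exact MeasurableSet.iInter fun i => MeasurableSet.iInter fun _ => h.measurableSet_state i Aᶜ
  · exact (h.measurable_prod_weight hw n).mul
      (((h.measurable_weight n hw).mul (h.measurable_comp _ f)).sub (h.measurable_comp _ f))

lemma integrable_stoppedIncrement (h : IsJumpProcess hold jump P X T) [Countable S]
    [IsFiniteMeasure P] {A : Set S}
    {w : S → ℝ → ℂ} (hw : ∀ x, Measurable (w x)) (hw1 : ∀ x, ∀ᵐ t ∂hold x, ‖w x t‖ ≤ 1)
    {f : S → ℂ} {C : ℝ} (hf : ∀ x, ‖f x‖ ≤ C) (n : ℕ) :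
    Integrable (stoppedIncrement X T A w f n) P := by
  refine Integrable.of_bound (h.measurable_stoppedIncrement hw f n).aestronglyMeasurable
    (C + C) ?_
  filter_upwards [h.ae_step hw1] with ω hω
  have hω' : ∀ n, ‖w (X n ω) (T n ω)‖ ≤ 1 := fun n => (hω n).2
  have hC : 0 ≤ C := (norm_nonneg _).trans (hf (X 0 ω))
  unfold stoppedIncrement
  split_ifs
  · rw [norm_mul]
    calc _ ≤ 1 * (‖w (X n ω) (T n ω) * f (X (n + 1) ω)‖ + ‖f (X n ω)‖) :=
          mul_le_mul (norm_prod_weight_le hω' n) (norm_sub_le _ _) (norm_nonneg _) zero_le_one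
      _ ≤ C + C := by
          rw [one_mul, norm_mul]
          gcongr
          · calc _ ≤ 1 * C := mul_le_mul (hω' n) (hf _) (norm_nonneg _) zero_le_one
              _ = C := one_mul C
          · exact hf _
  · simpa using add_nonneg hC hC

/-- Martingale property. Given the path up to `n`, the discount already accumulated, the sojourn in
`X n` and the next state are independent. The mean of the new term is therefore the accumulated
factor times the left side of `hharm`, which cancels the subtracted term. -/
lemma integral_stoppedIncrement (h : IsJumpProcess hold jump P X T) [Countable S]
    [IsFiniteMeasure P] {A R : Set S}
    {w : S → ℝ → ℂ} (hw : ∀ x, Measurable (w x)) (hw1 : ∀ x, ∀ᵐ t ∂hold x, ‖w x t‖ ≤ 1)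
    {f : S → ℂ} {C : ℝ} (hf : ∀ x, ‖f x‖ ≤ C)
    (hR : ∀ x ∈ R, x ∉ A → ∀ y, jump x y ≠ 0 → y ∈ R) (h0 : ∀ᵐ ω ∂P, X 0 ω ∈ R)
    (hharm : ∀ x ∈ R, x ∉ A → (∫ t, w x t ∂hold x) * ∑' y, (jump x y).toReal * f y = f x) (n : ℕ) :
    ∫ ω, stoppedIncrement X T A w f n ω ∂P = 0 := by
  refine h.integral_eq_zero_of_cyl n (h.integrable_stoppedIncrement hw hw1 hf n) fun x => ?_
  have hcm := h.measurableSet_cyl n x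
  by_cases hxA : ∀ i ≤ n, x i ∉ A
  swap
  · rw [setIntegral_congr_fun (g := fun _ => 0) hcm]
    · simp
    · intro ω hω
      push Not at hxA
      obtain ⟨i, hi, hiA⟩ := hxA
      simp only [stoppedIncrement]
      rw [if_neg]
      push Not
      exact ⟨i, hi, by rwa [hω i hi]⟩
  by_cases hP : P (cyl X n x) = 0
  · rw [Measure.restrict_eq_zero.2 hP]; simp
  -- Harmonicity is assumed only on `R`; a cylinder of positive probability that has avoided `A`
  -- must still be in `R`.
  have hxR : x n ∈ R := by
    by_contra hn
    apply hP
    refine measure_mono_null (fun ω hω => ?_) (ae_iff.1 (h.ae_mem_of_invariant hR h0))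
    simp only [Set.mem_ofPred_eq, not_forall]
    exact ⟨n, fun i hi => by rw [hω i hi.le]; exact hxA i hi.le, by rwa [hω n le_rfl]⟩
  have hb : ∀ᵐ ω ∂P, ∀ n, ‖w (X n ω) (T n ω)‖ ≤ 1 := by
    filter_upwards [h.ae_step hw1] with ω hω n using (hω n).2
  have hi1 : Integrable (fun ω => (∏ i ∈ Finset.range (n + 1), w (X i ω) (T i ω)) *
      f (X (n + 1) ω)) P := by
    refine Integrable.of_bound ((h.measurable_prod_weight hw _).mul
      (h.measurable_comp _ f)).aestronglyMeasurable (1 * C) ?_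
    filter_upwards [hb] with ω hω
    rw [norm_mul]
    exact mul_le_mul (norm_prod_weight_le hω _) (hf _) (norm_nonneg _) zero_le_one
  have hi2 : Integrable (fun ω => (∏ i ∈ Finset.range n, w (X i ω) (T i ω)) *
      f (X n ω)) P := by
    refine Integrable.of_bound ((h.measurable_prod_weight hw _).mul
      (h.measurable_comp _ f)).aestronglyMeasurable (1 * C) ?_
    filter_upwards [hb] with ω hω
    rw [norm_mul]
    exact mul_le_mul (norm_prod_weight_le hω _) (hf _) (norm_nonneg _) zero_le_one
  have e0 : ∫ ω in cyl X n x, stoppedIncrement X T A w f n ω ∂P =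
      ∫ ω in cyl X n x, ((∏ i ∈ Finset.range (n + 1), w (X i ω) (T i ω)) * f (X (n + 1) ω) -
        (∏ i ∈ Finset.range n, w (X i ω) (T i ω)) * f (X n ω)) ∂P := by
    refine setIntegral_congr_fun hcm fun ω hω => ?_
    simp only [stoppedIncrement]
    rw [if_pos (fun i hi => by rw [hω i hi]; exact hxA i hi), Finset.prod_range_succ]
    ring
  rw [e0, integral_sub hi1.integrableOn hi2.integrableOn, sub_eq_zero]
  set c : ℂ := (P (cyl X n x)).toReal * ∏ i ∈ Finset.range n, ∫ t, w (x i) t ∂hold (x i) with hc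
  have e2 : ∫ ω in cyl X n x, (∏ i ∈ Finset.range n, w (X i ω) (T i ω)) * f (X n ω) ∂P =
      c * f (x n) := by
    rw [hc, ← h.setIntegral_cyl_prod n x hw, ← integral_mul_const]
    refine setIntegral_congr_fun hcm fun ω hω => ?_
    rw [hω n le_rfl]
    congr 1
    refine Finset.prod_congr rfl fun i hi => ?_
    rw [hω i (Finset.mem_range.1 hi).le]
  have e1 : HasSum (fun y => c * (∫ t, w (x n) t ∂hold (x n)) * ((jump (x n) y).toReal * f y))
      (∫ ω in cyl X n x, (∏ i ∈ Finset.range (n + 1), w (X i ω) (T i ω)) *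
        f (X (n + 1) ω) ∂P) := by
    -- The cylinder is split according to the next state, because the law of the sojourn in `X n` is
    -- available only jointly with the jump that follows it.
    let ext : S → ℕ → S := fun y i => if i ≤ n then x i else y
    have hext : ∀ y, cyl X (n + 1) (ext y) = cyl X n x ∩ {ω | X (n + 1) ω = y} := by
      intro y
      ext ω
      constructor
      · intro hω
        refine ⟨fun i hi => ?_, ?_⟩
        · simpa [ext, hi] using hω i (by omega)
        · simpa [ext] using hω (n + 1) le_rfl
      · rintro ⟨h1, h2⟩ i hi
        by_cases hin : i ≤ n
        · simpa [ext, hin] using h1 i hin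
        · obtain rfl : i = n + 1 := by omega
          simpa [ext] using h2
    have hU : ⋃ y, cyl X (n + 1) (ext y) = cyl X n x := by
      simp_rw [hext, ← Set.inter_iUnion]
      ext ω; simp
    have := hasSum_integral_iUnion (μ := P) (fun y => h.measurableSet_cyl (n + 1) (ext y))
      (fun y z hyz => by
        rw [Function.onFun, hext, hext, Set.disjoint_left]
        rintro ω ⟨_, h1⟩ ⟨_, h2⟩
        exact hyz (h1.symm.trans h2)) hi1.integrableOn
    rw [hU] at this
    refine (congrArg (fun g => HasSum g _) (funext fun y => ?_)).mp this
    have e3 : ∫ ω in cyl X (n + 1) (ext y), (∏ i ∈ Finset.range (n + 1), w (X i ω) (T i ω)) *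
        f (X (n + 1) ω) ∂P = (∫ ω in cyl X (n + 1) (ext y),
          (∏ i ∈ Finset.range (n + 1), w (ext y i) (T i ω)) ∂P) * f y := by
      rw [← integral_mul_const]
      refine setIntegral_congr_fun (h.measurableSet_cyl _ _) fun ω hω => ?_
      have h3 : X (n + 1) ω = y := by simpa [ext] using hω (n + 1) le_rfl
      rw [h3]
      congr 1
      refine Finset.prod_congr rfl fun i hi => ?_
      rw [hω i (Finset.mem_range.1 hi).le]
    have e4 : P (cyl X (n + 1) (ext y)) = P (cyl X n x) * jump (x n) y := by
      have h5 : cyl X n (ext y) = cyl X n x := by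
        ext ω
        refine forall₂_congr fun i hi => ?_
        simp [ext, hi]
      rw [h.measure_cyl_succ, h5]
      simp [ext]
    refine e3.trans ?_
    rw [h.setIntegral_cyl_prod (n + 1) (ext y) hw, e4, hc, Finset.prod_range_succ]
    have h6 : ∏ i ∈ Finset.range n, ∫ t, w (ext y i) t ∂hold (ext y i) =
        ∏ i ∈ Finset.range n, ∫ t, w (x i) t ∂hold (x i) :=
      Finset.prod_congr rfl fun i hi => by simp [ext, (Finset.mem_range.1 hi).le]
    have h7 : ext y n = x n := by simp [ext]
    rw [h6, h7, ENNReal.toReal_mul]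
    push_cast
    ring
  rw [e2, ← e1.tsum_eq, tsum_mul_left, mul_assoc, hharm _ hxR (hxA n le_rfl)]

/-- Optional stopping at the first visit to `A` for a bounded function that is harmonic with respect
to the discounted jump process. -/
theorem integral_optional_stopping (h : IsJumpProcess hold jump P X T) [Countable S]
    [IsFiniteMeasure P] {A R : Set S}
    {w : S → ℝ → ℂ} (hw : ∀ x, Measurable (w x)) (hw1 : ∀ x, ∀ᵐ t ∂hold x, ‖w x t‖ ≤ 1)
    {f : S → ℂ} {C : ℝ} (hf : ∀ x, ‖f x‖ ≤ C)
    (hR : ∀ x ∈ R, x ∉ A → ∀ y, jump x y ≠ 0 → y ∈ R) (h0 : ∀ᵐ ω ∂P, X 0 ω ∈ R)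
    (hharm : ∀ x ∈ R, x ∉ A → (∫ t, w x t ∂hold x) * ∑' y, (jump x y).toReal * f y = f x)
    (hhit : ∀ᵐ ω ∂P, ∃ n, X n ω ∈ A) :
    ∫ ω, (∏ i ∈ Finset.range (sInf {n | X n ω ∈ A}), w (X i ω) (T i ω)) *
      f (X (sInf {n | X n ω ∈ A}) ω) ∂P = ∫ ω, f (X 0 ω) ∂P := by
  have hf0 : Integrable (fun ω => f (X 0 ω)) P :=
    Integrable.of_bound (h.measurable_comp 0 f).aestronglyMeasurable C (by simp [hf])
  have hM : ∀ n, ∫ ω, (f (X 0 ω) + ∑ i ∈ Finset.range n, stoppedIncrement X T A w f i ω) ∂P =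
      ∫ ω, f (X 0 ω) ∂P := by
    intro n
    rw [integral_add hf0 (integrable_finsetSum _ fun i _ =>
        h.integrable_stoppedIncrement hw hw1 hf i),
      integral_finsetSum _ fun i _ => h.integrable_stoppedIncrement hw hw1 hf i,
      Finset.sum_eq_zero fun i _ => h.integral_stoppedIncrement hw hw1 hf hR h0 hharm i, add_zero]
  -- The partial sums equal the stopped discounted process: they are bounded by `C` since all
  -- weights have norm at most one, and they are eventually constant since `A` is reached.
  have hlim := tendsto_integral_of_dominated_convergence (μ := P)
    (F := fun n ω => f (X 0 ω) + ∑ i ∈ Finset.range n, stoppedIncrement X T A w f i ω)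
    (f := fun ω => (∏ i ∈ Finset.range (sInf {n | X n ω ∈ A}), w (X i ω) (T i ω)) *
      f (X (sInf {n | X n ω ∈ A}) ω)) (fun _ => 1 * C)
    (fun n => ((h.measurable_comp 0 f).add (Finset.measurable_fun_sum _ fun i _ =>
        h.measurable_stoppedIncrement hw f i)).aestronglyMeasurable)
    (integrable_const _) ?_ ?_
  · simp only [hM] at hlim
    exact tendsto_nhds_unique hlim tendsto_const_nhds
  · intro n
    filter_upwards [hhit, h.ae_step hw1] with ω h1 h2
    rw [sum_stoppedIncrement (τ := sInf {n | X n ω ∈ A}) A w f (Nat.sInf_mem h1)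
      (fun i hi => Nat.notMem_of_lt_sInf hi),
      norm_mul]
    exact mul_le_mul (norm_prod_weight_le (fun n => (h2 n).2) _) (hf _) (norm_nonneg _)
      zero_le_one
  · filter_upwards [hhit] with ω h1
    refine tendsto_const_nhds.congr' ?_
    filter_upwards [eventually_ge_atTop (sInf {n | X n ω ∈ A})] with n hn
    rw [sum_stoppedIncrement (τ := sInf {n | X n ω ∈ A}) A w f (Nat.sInf_mem h1)
      (fun i hi => Nat.notMem_of_lt_sInf hi),
      min_eq_right hn]

end IsJumpProcess

/-! ### Exponential holding times -/

lemma ae_nonneg_expMeasure (r : ℝ) : ∀ᵐ t ∂expMeasure r, 0 ≤ t := by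
  have hm : Measurable (gammaPDF 1 r) := (measurable_gammaPDFReal 1 r).ennreal_ofReal
  rw [expMeasure, gammaMeasure, ae_withDensity_iff hm]
  refine ae_of_all _ fun t ht => ?_
  by_contra h
  exact ht (gammaPDF_of_neg (not_le.1 h))

lemma integral_expMeasure {r : ℝ} (hr : 0 < r) {s : ℂ} (hs : 0 ≤ s.re) :
    ∫ t, Complex.exp (-s * (t : ℂ)) ∂expMeasure r = r / (r + s) := by
  have hre : (-(r + s) : ℂ).re < 0 := by simp; linarith
  have hne : (r + s : ℂ) ≠ 0 := by
    intro h; rw [h] at hre; simp at hre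
  have hm : Measurable (gammaPDF 1 r) := (measurable_gammaPDFReal 1 r).ennreal_ofReal
  rw [expMeasure, gammaMeasure, integral_withDensity_eq_integral_toReal_smul hm
    (ae_of_all _ fun _ => ENNReal.ofReal_lt_top)]
  have : ∀ t : ℝ, (gammaPDF 1 r t).toReal • Complex.exp (-s * (t : ℂ)) =
      (Set.Ici 0).indicator (fun t : ℝ => (r : ℂ) * Complex.exp (-(r + s) * t)) t := by
    intro t
    by_cases ht : 0 ≤ t
    · rw [Set.indicator_of_mem (by exact ht), gammaPDF_of_nonneg ht, ENNReal.toReal_ofReal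
        (by positivity)]
      simp only [Real.rpow_one, Real.Gamma_one, div_one, sub_self, Real.rpow_zero, mul_one,
        Complex.real_smul, Complex.ofReal_mul, Complex.ofReal_exp, mul_assoc, ← Complex.exp_add]
      congr 2
      push_cast
      ring
    · rw [Set.indicator_of_notMem (by exact ht), gammaPDF_of_neg (not_le.1 ht)]
      simp
  simp_rw [this]
  rw [integral_indicator measurableSet_Ici, integral_Ici_eq_integral_Ioi, integral_const_mul,
    integral_exp_mul_complex_Ioi hre]
  field_simp
  simp

lemma norm_exp_neg_mul_le {s : ℂ} (hs : 0 ≤ s.re) {t : ℝ} (ht : 0 ≤ t) :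
    ‖Complex.exp (-s * (t : ℂ))‖ ≤ 1 := by
  rw [Complex.norm_exp, Real.exp_le_one_iff]
  simp
  positivity

/-! ### The quadratic equation of the busy period -/

/-- The quadratic is a fixed-point equation for a contraction of the closed unit disc. Strict
inequality `lam < mu` keeps it a contraction on the boundary line `s.re = 0` as well, in particular
at `s = 0`. Uniqueness of the root is not needed, since optional stopping identifies any root in the
disc. -/
lemma exists_busy_root {lam mu : ℝ} (hlam : 0 < lam) (hlt : lam < mu) {s : ℂ} (hs : 0 ≤ s.re) :
    ∃ r : ℂ, ‖r‖ ≤ 1 ∧ lam * r ^ 2 + mu = (lam + mu + s) * r := by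
  set d : ℂ := lam + mu + s with hd
  have hdn : lam + mu ≤ ‖d‖ := by
    refine le_trans ?_ (Complex.re_le_norm d)
    simp [hd]; linarith
  have hd0 : 0 < ‖d‖ := by linarith
  have hdne : d ≠ 0 := norm_pos_iff.1 hd0
  let g : ℂ → ℂ := fun r => (lam * r ^ 2 + mu) / d
  have hmaps : Set.MapsTo g (Metric.closedBall 0 1) (Metric.closedBall 0 1) := by
    intro r hr
    rw [mem_closedBall_zero_iff] at hr ⊢
    rw [norm_div, div_le_one hd0]
    refine le_trans (norm_add_le _ _) (le_trans ?_ hdn)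
    rw [norm_mul, norm_pow, Complex.norm_of_nonneg hlam.le,
      Complex.norm_of_nonneg (hlam.trans hlt).le]
    have : ‖r‖ ^ 2 ≤ 1 := pow_le_one₀ (norm_nonneg _) hr
    nlinarith
  -- The Lipschitz constant comes from `‖x + y‖ ≤ 2` on the disc and `lam + mu ≤ ‖d‖`.
  have hK : 0 ≤ 2 * lam / (lam + mu) := div_nonneg (by linarith) (by linarith)
  have hK1 : 2 * lam / (lam + mu) < 1 := by rw [div_lt_one (by linarith)]; linarith
  obtain ⟨K, hKc⟩ : ∃ K : NNReal, (K : ℝ) = 2 * lam / (lam + mu) := ⟨⟨_, hK⟩, rfl⟩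
  have hcontr : ContractingWith K
      (hmaps.restrict g (Metric.closedBall 0 1) (Metric.closedBall 0 1)) := by
    refine ⟨by rw [← NNReal.coe_lt_coe, hKc]; exact hK1, LipschitzWith.of_dist_le_mul ?_⟩
    rintro ⟨x, hx⟩ ⟨y, hy⟩
    rw [mem_closedBall_zero_iff] at hx hy
    simp only [Subtype.dist_eq, Set.MapsTo.val_restrict_apply, dist_eq_norm]
    have : g x - g y = lam * (x + y) / d * (x - y) := by
      simp only [g]; field_simp; ring
    rw [this, norm_mul]
    gcongr
    rw [norm_div, norm_mul, Complex.norm_of_nonneg hlam.le]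
    have : ‖x + y‖ ≤ 2 := (norm_add_le _ _).trans (by linarith)
    rw [hKc, mul_comm 2 lam]
    gcongr
    linarith
  obtain ⟨y, hy, hfix, -⟩ := ContractingWith.exists_fixedPoint'
    (Metric.isClosed_closedBall.isComplete) hmaps hcontr
    (x := 0) (by simp) (edist_ne_top _ _)
  refine ⟨y, by simpa using hy, ?_⟩
  have : (lam * y ^ 2 + mu) / d = y := hfix
  rw [div_eq_iff hdne] at this
  rw [this, mul_comm]

/-! ### The busy period of an M/M/1 queue -/

lemma isProbabilityMeasure_mm1Hold {lam mu : ℝ} (hlam : 0 < lam) (hmu : 0 < mu) (n : ℕ) :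
    IsProbabilityMeasure (mm1Hold lam mu n) := by
  unfold mm1Hold
  apply isProbabilityMeasure_expMeasure
  split_ifs <;> linarith

lemma mm1Step_succ {lam mu : ℝ} (n m : ℕ) :
    mm1Step lam mu (n + 1) m = (if m = n + 2 then ENNReal.ofReal (lam / (lam + mu)) else 0) +
      (if m = n then ENNReal.ofReal (mu / (lam + mu)) else 0) := by
  unfold mm1Step
  by_cases h1 : m = n + 2
  · subst h1; simp
  · by_cases h2 : m = n
    · subst h2; simp [h1]
    · simp [h1, h2]

section MM1

variable {Ω : Type*} [MeasurableSpace Ω] {lam mu : ℝ} {Q : Measure Ω} [IsProbabilityMeasure Q]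
  {Y : ℕ → Ω → ℕ} {U : ℕ → Ω → ℝ}

lemma mm1_ae_empty (hlam : 0 < lam) (hlt : lam < mu) (hY : IsMM1FromOne lam mu Q Y U) :
    ∀ᵐ ω ∂Q, ∃ n, Y n ω = 0 := by
  have hmu : 0 < mu := hlam.trans hlt
  have := isProbabilityMeasure_mm1Hold hlam hmu
  -- The slope for which the linear function `n * d` has one-step drift exactly `-1` away from zero.
  set d : ℝ := (lam + mu) / (mu - lam) with hd
  have hd0 : 0 ≤ d := div_nonneg (by linarith) (by linarith)
  refine hY.1.ae_exists_mem (A := {0}) (V := fun n => ENNReal.ofReal (n * d)) ?_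
    (ae_of_all _ fun _ => ENNReal.ofReal_ne_top)
  intro x hx
  obtain ⟨n, rfl⟩ := Nat.exists_eq_succ_of_ne_zero hx
  simp only [Nat.succ_eq_add_one, mm1Step_succ, add_mul, ite_mul, zero_mul]
  rw [ENNReal.tsum_add, tsum_ite_eq, tsum_ite_eq, ← ENNReal.ofReal_mul (by positivity),
    ← ENNReal.ofReal_mul (by positivity), ← ENNReal.ofReal_add (by positivity) (by positivity),
    ← ENNReal.ofReal_one, ← ENNReal.ofReal_add (by positivity) (by positivity)]
  apply ENNReal.ofReal_le_ofReal
  push_cast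
  have hne : mu - lam ≠ 0 := by linarith
  have hne' : lam + mu ≠ 0 := by linarith
  apply le_of_eq
  rw [hd]
  field_simp
  ring

/-- From `n` jobs the queue empties after `n` successive one-job passages, which suggests the
function `r ^ n`. The quadratic says exactly that it is harmonic for the discounted queue; its value
is `1` at the empty state and `r` at the start. -/
lemma mm1_lst_busyPeriod (hlam : 0 < lam) (hlt : lam < mu) (hY : IsMM1FromOne lam mu Q Y U)
    {s r : ℂ} (hs : 0 ≤ s.re) (hr1 : ‖r‖ ≤ 1) (hr : lam * r ^ 2 + mu = (lam + mu + s) * r) :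
    lst Q (busyPeriod Y U) s = r := by
  have hmu : 0 < mu := hlam.trans hlt
  have := isProbabilityMeasure_mm1Hold hlam hmu
  have key := hY.1.integral_optional_stopping (A := {0}) (R := Set.univ)
    (w := fun _ t => Complex.exp (-s * (t : ℂ))) (f := fun n => r ^ n) (C := 1)
    (fun _ => by fun_prop)
    (fun n => (ae_nonneg_expMeasure _).mono fun t ht => norm_exp_neg_mul_le hs ht)
    (fun n => by rw [norm_pow]; exact pow_le_one₀ (norm_nonneg _) hr1)
    (fun _ _ _ _ _ => trivial) (by simp) ?_ (mm1_ae_empty hlam hlt hY)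
  · have e1 : ∫ ω, r ^ Y 0 ω ∂Q = r := by
      rw [integral_congr_ae (g := fun _ => r) (hY.2.mono fun ω h => by simp [h])]
      simp
    rw [e1] at key
    rw [← key, lst]
    refine integral_congr_ae ((mm1_ae_empty hlam hlt hY).mono fun ω hω => ?_)
    have h0 : Y (sInf {n | Y n ω ∈ ({0} : Set ℕ)}) ω = 0 := Nat.sInf_mem (s := {n | Y n ω = 0}) hω
    simp only [h0, pow_zero, mul_one, busyPeriod]
    rw [← Complex.exp_sum, ← Finset.mul_sum]
    simp
  · intro x _ hx
    obtain ⟨n, rfl⟩ := Nat.exists_eq_succ_of_ne_zero hx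
    have hre : 0 < (lam + mu + s : ℂ).re := by simp; linarith
    have hne : (lam + mu + s : ℂ) ≠ 0 := by
      intro h; rw [h] at hre; simp at hre
    have hne' : (lam + mu : ℂ) ≠ 0 := by
      exact_mod_cast (show lam + mu ≠ 0 by linarith)
    have e1 : ∑' y, ((mm1Step lam mu (n + 1) y).toReal : ℂ) * r ^ y =
        (lam / (lam + mu)) * r ^ (n + 2) + (mu / (lam + mu)) * r ^ n := by
      rw [tsum_eq_sum (s := {n + 2, n})]
      · rw [Finset.sum_pair (by omega)]
        simp only [mm1Step_succ]
        rw [if_pos trivial, if_neg (by omega), if_neg (by omega), if_pos trivial,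
          add_zero, zero_add, ENNReal.toReal_ofReal (by positivity),
          ENNReal.toReal_ofReal (by positivity)]
        push_cast
        ring
      · intro b hb
        simp only [Finset.mem_insert, Finset.mem_singleton, not_or] at hb
        simp [mm1Step_succ, hb.1, hb.2]
    rw [Nat.succ_eq_add_one, e1, mm1Hold, if_neg (by omega), integral_expMeasure (by linarith) hs]
    push_cast
    field_simp
    linear_combination r ^ n * hr

end MM1

/-! ### Steps of the one-or-all system -/

instance : Countable Phase := by
  refine Function.Injective.countable (f := fun p : Phase =>
    match p with | .one => (1 : ℕ) | .two => 2 | .three => 3 | .four => 4) ?_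
  intro p q h
  cases p <;> cases q <;> simp_all

instance : Countable State :=
  Function.Injective.countable (f := fun x : State => (x.phase, x.nS, x.nL, x.uS, x.uL))
    fun x y h => by ext <;> simp_all

lemma State.phase_admit (k : ℕ) (x : State) : (State.admit k x).phase = x.phase := by
  simp only [State.admit]
  split <;> simp_all

section Steps

variable {k l : ℕ} {lamS lamL muS muL : ℝ}

lemma totalRate_pos (hlamS : 0 < lamS) (hlamL : 0 < lamL) (hmuS : 0 < muS) (hmuL : 0 < muL)
    (x : State) : 0 < totalRate lamS lamL muS muL x := by
  unfold totalRate; positivity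

lemma isProbabilityMeasure_holdLaw (hlamS : 0 < lamS) (hlamL : 0 < lamL) (hmuS : 0 < muS)
    (hmuL : 0 < muL) (x : State) : IsProbabilityMeasure (holdLaw k l lamS lamL muS muL x) := by
  unfold holdLaw
  split_ifs
  · infer_instance
  · exact isProbabilityMeasure_expMeasure (totalRate_pos hlamS hlamL hmuS hmuL x)

lemma ae_nonneg_holdLaw (x : State) : ∀ᵐ t ∂holdLaw k l lamS lamL muS muL x, 0 ≤ t := by
  unfold holdLaw
  split_ifs
  · rw [ae_dirac_iff measurableSet_Ici]
  · exact ae_nonneg_expMeasure _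

/-- `R` is invariant under the transitions that are possible outside `A`. -/
def Invariant (k l : ℕ) (A R : Set State) : Prop :=
  ∀ x ∈ R, x ∉ A → (x.PhaseOver k l → x.advance k ∈ R) ∧ (¬ x.PhaseOver k l →
    x.arriveS k ∈ R ∧ x.arriveL k ∈ R ∧ (x.uS ≠ 0 → x.departS k ∈ R) ∧
      (x.uL ≠ 0 → x.departL k ∈ R))

lemma stepProb_ne_zero {x y : State} (h : stepProb k l lamS lamL muS muL x y ≠ 0) :
    (x.PhaseOver k l ∧ y = x.advance k) ∨ (¬ x.PhaseOver k l ∧ (y = x.arriveS k ∨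
      y = x.arriveL k ∨ (x.uS ≠ 0 ∧ y = x.departS k) ∨ (x.uL ≠ 0 ∧ y = x.departL k))) := by
  unfold stepProb at h
  by_cases h1 : x.PhaseOver k l
  · rw [if_pos h1] at h
    exact Or.inl ⟨h1, by by_contra h2; exact h (if_neg h2)⟩
  · rw [if_neg h1] at h
    refine Or.inr ⟨h1, ?_⟩
    by_contra! hn
    obtain ⟨n1, n2, n3, n4⟩ := hn
    apply h
    rw [if_neg n1, if_neg n2]
    have e3 : (if y = x.departS k then (x.uS : ℝ) * muS else 0) = 0 := by
      split_ifs with h3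
      · have : x.uS = 0 := by by_contra h4; exact n3 h4 h3
        simp [this]
      · rfl
    have e4 : (if y = x.departL k then (x.uL : ℝ) * muL else 0) = 0 := by
      split_ifs with h3
      · have : x.uL = 0 := by by_contra h4; exact n4 h4 h3
        simp [this]
      · rfl
    rw [e3, e4]
    simp

lemma Invariant.mem {A R : Set State} (hR : Invariant k l A R) {x : State} (hx : x ∈ R)
    (hA : x ∉ A) {y : State} (hy : stepProb k l lamS lamL muS muL x y ≠ 0) : y ∈ R := by
  obtain ⟨h1, h2⟩ := hR x hx hA
  rcases stepProb_ne_zero hy with ⟨h, rfl⟩ | ⟨h, rfl | rfl | ⟨h', rfl⟩ | ⟨h', rfl⟩⟩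
  · exact h1 h
  · exact (h2 h).1
  · exact (h2 h).2.1
  · exact (h2 h).2.2.1 h'
  · exact (h2 h).2.2.2 h'

lemma phase_step {x y : State} (h : stepProb k l lamS lamL muS muL x y ≠ 0) :
    y.phase = x.phase ∨ y.phase = x.phase.next := by
  rcases stepProb_ne_zero h with ⟨-, rfl⟩ | ⟨-, rfl | rfl | ⟨-, rfl⟩ | ⟨-, rfl⟩⟩ <;>
  simp [State.advance, State.arriveS, State.arriveL, State.departS, State.departL,
    State.phase_admit]

/-- Arrivals and completions preserve the phase, so phase 2 can only be entered through the end of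
phase 1, when no large job is left. -/
lemma step_one_two {x y : State} (h : stepProb k l lamS lamL muS muL x y ≠ 0)
    (hx : x.phase = .one) (hy : y.phase = .two) : y.nL = 0 ∧ y.uS = min y.nS k ∧ y.uL = 0 := by
  rcases stepProb_ne_zero h with ⟨ho, rfl⟩ | ⟨-, rfl | rfl | ⟨-, rfl⟩ | ⟨-, rfl⟩⟩
  · simp only [State.PhaseOver, hx] at ho
    simp [State.advance, State.admit, hx, Phase.next, ho]
  all_goals simp [State.arriveS, State.arriveL, State.departS, State.departL,
    State.phase_admit, hx] at hy

/-- `stepProb` adds the rates of events that lead to the same state, so the sum separates into four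
terms even when target states coincide. -/
lemma tsum_stepProb_mul (hlamS : 0 < lamS) (hlamL : 0 < lamL) (hmuS : 0 < muS) (hmuL : 0 < muL)
    {x : State} (hx : ¬ x.PhaseOver k l) (V : State → ENNReal) :
    ∑' y, stepProb k l lamS lamL muS muL x y * V y =
      ENNReal.ofReal (lamS / totalRate lamS lamL muS muL x) * V (x.arriveS k) +
      ENNReal.ofReal (lamL / totalRate lamS lamL muS muL x) * V (x.arriveL k) +
      ENNReal.ofReal (x.uS * muS / totalRate lamS lamL muS muL x) * V (x.departS k) +
      ENNReal.ofReal (x.uL * muL / totalRate lamS lamL muS muL x) * V (x.departL k) := by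
  have hr := totalRate_pos hlamS hlamL hmuS hmuL x
  have : ∀ y, stepProb k l lamS lamL muS muL x y * V y =
      (if y = x.arriveS k then
        ENNReal.ofReal (lamS / totalRate lamS lamL muS muL x) * V (x.arriveS k) else 0) +
      (if y = x.arriveL k then
        ENNReal.ofReal (lamL / totalRate lamS lamL muS muL x) * V (x.arriveL k) else 0) +
      (if y = x.departS k then
        ENNReal.ofReal (x.uS * muS / totalRate lamS lamL muS muL x) * V (x.departS k) else 0) +
      (if y = x.departL k then
        ENNReal.ofReal (x.uL * muL / totalRate lamS lamL muS muL x) * V (x.departL k) else 0) := by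
    intro y
    have e : ∀ (q : ℝ) (z : State),
        (if y = z then ENNReal.ofReal (q / totalRate lamS lamL muS muL x) * V z else 0) =
        ENNReal.ofReal ((if y = z then q else 0) / totalRate lamS lamL muS muL x) * V y := by
      intro q z
      split_ifs with h
      · rw [h]
      · simp
    have p : ∀ (q : ℝ) (z : State), 0 ≤ q →
        0 ≤ (if y = z then q else 0) / totalRate lamS lamL muS muL x := by
      intro q z hq
      split_ifs <;> positivity
    have p1 := p lamS (x.arriveS k) hlamS.le
    have p2 := p lamL (x.arriveL k) hlamL.le
    have p3 := p (x.uS * muS) (x.departS k) (by positivity)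
    have p4 := p (x.uL * muL) (x.departL k) (by positivity)
    rw [e, e, e, e, ← add_mul, ← add_mul, ← add_mul, ← ENNReal.ofReal_add p1 p2,
      ← ENNReal.ofReal_add (add_nonneg p1 p2) p3,
      ← ENNReal.ofReal_add (add_nonneg (add_nonneg p1 p2) p3) p4, stepProb, if_neg hx]
    simp only [add_div]
  simp_rw [this]
  rw [ENNReal.tsum_add, ENNReal.tsum_add, ENNReal.tsum_add, tsum_ite_eq, tsum_ite_eq,
    tsum_ite_eq, tsum_ite_eq]

lemma tsum_toReal_stepProb_mul (hlamS : 0 < lamS) (hlamL : 0 < lamL) (hmuS : 0 < muS)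
    (hmuL : 0 < muL) {x : State} (hx : ¬ x.PhaseOver k l) (f : State → ℂ) :
    ∑' y, ((stepProb k l lamS lamL muS muL x y).toReal : ℂ) * f y =
      (lamS * f (x.arriveS k) + lamL * f (x.arriveL k) + x.uS * muS * f (x.departS k) +
        x.uL * muL * f (x.departL k)) / totalRate lamS lamL muS muL x := by
  have hr := totalRate_pos hlamS hlamL hmuS hmuL x
  have : ∀ y, ((stepProb k l lamS lamL muS muL x y).toReal : ℂ) * f y =
      ((if y = x.arriveS k then lamS * f (x.arriveS k) else 0) +
      (if y = x.arriveL k then lamL * f (x.arriveL k) else 0) +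
      (if y = x.departS k then x.uS * muS * f (x.departS k) else 0) +
      (if y = x.departL k then x.uL * muL * f (x.departL k) else 0)) /
        totalRate lamS lamL muS muL x := by
    intro y
    have e : ∀ (q : ℝ) (z : State), (if y = z then (q : ℂ) * f z else 0) =
        ((if y = z then q else 0 : ℝ) : ℂ) * f y := by
      intro q z
      split_ifs with h
      · rw [h]
      · simp
    have p : ∀ (q : ℝ) (z : State), 0 ≤ q → 0 ≤ (if y = z then q else 0) := by
      intro q z hq
      split_ifs <;> simp [hq]
    have p1 := p lamS (x.arriveS k) hlamS.le
    have p2 := p lamL (x.arriveL k) hlamL.le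
    have p3 := p (x.uS * muS) (x.departS k) (by positivity)
    have p4 := p (x.uL * muL) (x.departL k) (by positivity)
    have e3 := e (x.uS * muS) (x.departS k)
    have e4 := e (x.uL * muL) (x.departL k)
    push_cast at e3 e4
    rw [e, e, e3, e4, stepProb, if_neg hx, ENNReal.toReal_ofReal (by positivity)]
    push_cast
    ring
  simp_rw [this]
  exact (((((hasSum_ite_eq _ _).add (hasSum_ite_eq _ _)).add (hasSum_ite_eq _ _)).add
    (hasSum_ite_eq _ _)).div_const _).tsum_eq

/-- With total rate `q`, the sojourn contributes `q / (q + s)` and the jump averages with weights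
rate divided by `q`; cancelling `q` leaves the generator equation `hf`. -/
lemma harmonic_of_not_phaseOver (hlamS : 0 < lamS) (hlamL : 0 < lamL) (hmuS : 0 < muS)
    (hmuL : 0 < muL) {x : State} (hx : ¬ x.PhaseOver k l) {f : State → ℂ} {s : ℂ} (hs : 0 ≤ s.re)
    (hf : lamS * f (x.arriveS k) + lamL * f (x.arriveL k) + x.uS * muS * f (x.departS k) +
      x.uL * muL * f (x.departL k) = (lamS + lamL + x.uS * muS + x.uL * muL + s) * f x) :
    (∫ t, Complex.exp (-s * (t : ℂ)) ∂holdLaw k l lamS lamL muS muL x) *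
      ∑' y, ((stepProb k l lamS lamL muS muL x y).toReal : ℂ) * f y = f x := by
  have hr := totalRate_pos hlamS hlamL hmuS hmuL x
  have hr' : (totalRate lamS lamL muS muL x : ℂ) ≠ 0 := by exact_mod_cast hr.ne'
  have hre : 0 < (totalRate lamS lamL muS muL x + s : ℂ).re := by simp; linarith
  have hne : (totalRate lamS lamL muS muL x + s : ℂ) ≠ 0 := by
    intro h; rw [h] at hre; simp at hre
  rw [tsum_toReal_stepProb_mul hlamS hlamL hmuS hmuL hx, hf, holdLaw, if_neg hx,
    integral_expMeasure hr hs]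
  field_simp
  simp only [totalRate]
  push_cast
  ring

lemma harmonic_of_phaseOver {x : State} (hx : x.PhaseOver k l) {f : State → ℂ} {s : ℂ}
    (hf : f (x.advance k) = f x) :
    (∫ t, Complex.exp (-s * (t : ℂ)) ∂holdLaw k l lamS lamL muS muL x) *
      ∑' y, ((stepProb k l lamS lamL muS muL x y).toReal : ℂ) * f y = f x := by
  have : ∀ y, ((stepProb k l lamS lamL muS muL x y).toReal : ℂ) * f y =
      if y = x.advance k then f (x.advance k) else 0 := by
    intro y
    rw [stepProb, if_pos hx]
    split_ifs with h
    · simp [h]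
    · simp
  simp_rw [this]
  rw [tsum_ite_eq, holdLaw, if_pos hx, integral_dirac, hf]
  simp

/-! ### Foster's criterion and optional stopping in terms of event rates -/

section Run

variable {Ω : Type*} [MeasurableSpace Ω] {P : Measure Ω} [IsFiniteMeasure P]
  {X : ℕ → Ω → State} {T : ℕ → Ω → ℝ}

/-- Foster's criterion for the system. -/
lemma IsRun.ae_exists_mem (h : IsRun k l lamS lamL muS muL P X T)
    (hlamS : 0 < lamS) (hlamL : 0 < lamL) (hmuS : 0 < muS)
    (hmuL : 0 < muL) {A R : Set State} (hR : Invariant k l A R) {v : State → ℝ} (hv : ∀ x, 0 ≤ v x)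
    (hover : ∀ x ∈ R, x ∉ A → x.PhaseOver k l → v (x.advance k) + 1 ≤ v x)
    (hdrift : ∀ x ∈ R, x ∉ A → ¬ x.PhaseOver k l →
      lamS * v (x.arriveS k) + lamL * v (x.arriveL k) + x.uS * muS * v (x.departS k) +
        x.uL * muL * v (x.departL k) + (lamS + lamL + x.uS * muS + x.uL * muL) ≤
        (lamS + lamL + x.uS * muS + x.uL * muL) * v x)
    (h0 : ∀ᵐ ω ∂P, X 0 ω ∈ R) : ∀ᵐ ω ∂P, ∃ n, X n ω ∈ A := by
  classical
  have := isProbabilityMeasure_holdLaw (k := k) (l := l) hlamS hlamL hmuS hmuL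
  -- Setting the function to `⊤` off `R` makes the drift condition trivial there. Inside `R`,
  -- transitions of rate zero may lead out of `R`, but `0 * ⊤ = 0`.
  refine IsJumpProcess.ae_exists_mem h (V := fun x => if x ∈ R then ENNReal.ofReal (v x) else ⊤)
    ?_ (h0.mono fun ω hω => by simp [hω])
  intro x hA
  by_cases hx : x ∈ R
  swap
  · simp [hx]
  rw [if_pos hx]
  by_cases ho : x.PhaseOver k l
  · have : ∀ y, (stepProb k l lamS lamL muS muL x y) * (if y ∈ R then ENNReal.ofReal (v y) else ⊤) =
        if y = x.advance k then ENNReal.ofReal (v (x.advance k)) else 0 := by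
      intro y
      rw [stepProb, if_pos ho]
      by_cases h1 : y = x.advance k
      · simp [h1, (hR x hx hA).1 ho]
      · simp [h1]
    simp_rw [this]
    rw [tsum_ite_eq, ← ENNReal.ofReal_one, ← ENNReal.ofReal_add (hv _) zero_le_one]
    exact ENNReal.ofReal_le_ofReal (hover x hx hA ho)
  · rw [tsum_stepProb_mul hlamS hlamL hmuS hmuL ho]
    have hr := totalRate_pos hlamS hlamL hmuS hmuL x
    have e : ∀ (q : ℝ) (y : State), 0 ≤ q → (q ≠ 0 → y ∈ R) →
        ENNReal.ofReal (q / totalRate lamS lamL muS muL x) *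
          (if y ∈ R then ENNReal.ofReal (v y) else ⊤) =
        ENNReal.ofReal (q * v y / totalRate lamS lamL muS muL x) := by
      intro q y hq hy
      by_cases h0 : q = 0
      · simp [h0]
      · rw [if_pos (hy h0), ← ENNReal.ofReal_mul (by positivity)]
        congr 1; ring
    obtain ⟨h1, h2, h3, h4⟩ := (hR x hx hA).2 ho
    rw [e _ _ hlamS.le (fun _ => h1), e _ _ hlamL.le (fun _ => h2),
      e _ _ (by positivity) (fun h => h3 fun h' => h (by simp [h'])),
      e _ _ (by positivity) (fun h => h4 fun h' => h (by simp [h']))]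
    have p1 := hv (x.arriveS k)
    have p2 := hv (x.arriveL k)
    have p3 := hv (x.departS k)
    have p4 := hv (x.departL k)
    rw [← ENNReal.ofReal_one, ← ENNReal.ofReal_add (by positivity) (by positivity),
      ← ENNReal.ofReal_add (by positivity) (by positivity),
      ← ENNReal.ofReal_add (by positivity) (by positivity),
      ← ENNReal.ofReal_add (by positivity) (by positivity)]
    apply ENNReal.ofReal_le_ofReal
    rw [← add_div, ← add_div, ← add_div, div_add_one hr.ne', div_le_iff₀ hr]
    have := hdrift x hx hA ho
    simp only [totalRate]
    linarith

/-- Optional stopping for the system, with a discount rate for each phase. -/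
lemma IsRun.integral_optional_stopping (h : IsRun k l lamS lamL muS muL P X T)
    (hlamS : 0 < lamS) (hlamL : 0 < lamL) (hmuS : 0 < muS)
    (hmuL : 0 < muL) {A R : Set State} (hR : Invariant k l A R) {σ : Phase → ℂ}
    (hσ : ∀ p, 0 ≤ (σ p).re) {f : State → ℂ} (hf : ∀ x, ‖f x‖ ≤ 1)
    (hover : ∀ x ∈ R, x ∉ A → x.PhaseOver k l → f (x.advance k) = f x)
    (hharm : ∀ x ∈ R, x ∉ A → ¬ x.PhaseOver k l →
      lamS * f (x.arriveS k) + lamL * f (x.arriveL k) + x.uS * muS * f (x.departS k) +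
        x.uL * muL * f (x.departL k) =
        (lamS + lamL + x.uS * muS + x.uL * muL + σ x.phase) * f x)
    (h0 : ∀ᵐ ω ∂P, X 0 ω ∈ R) (hhit : ∀ᵐ ω ∂P, ∃ n, X n ω ∈ A) :
    ∫ ω, (∏ i ∈ Finset.range (sInf {n | X n ω ∈ A}),
        Complex.exp (-σ (X i ω).phase * (T i ω : ℂ))) *
      f (X (sInf {n | X n ω ∈ A}) ω) ∂P = ∫ ω, f (X 0 ω) ∂P := by
  have := isProbabilityMeasure_holdLaw (k := k) (l := l) hlamS hlamL hmuS hmuL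
  refine IsJumpProcess.integral_optional_stopping h
    (w := fun x t => Complex.exp (-σ x.phase * (t : ℂ))) (R := R) (C := 1)
    (fun _ => by fun_prop)
    (fun x => (ae_nonneg_holdLaw x).mono fun t ht => norm_exp_neg_mul_le (hσ _) ht) hf
    (fun x hx hA y hy => hR.mem hx hA hy) h0 (fun x hx hA => ?_) hhit
  by_cases ho : x.PhaseOver k l
  · exact harmonic_of_phaseOver ho (hover x hx hA ho)
  · exact harmonic_of_not_phaseOver hlamS hlamL hmuS hmuL ho (hσ _) (hharm x hx hA ho)

end Run

end Steps

/-! ### One-step-down transforms -/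

/-- Transforms of the passage times from `n` to `n - 1` small jobs, with `min n k` servers busy. -/
lemma exists_passage_transform {k : ℕ} {lamS muS : ℝ} (hlamS : 0 < lamS)
    (hmuS : 0 < muS) (hlt : lamS < k * muS) {ξ : ℂ} (hξ : 0 ≤ ξ.re) :
    ∃ g : ℕ → ℂ, (∀ n, ‖g n‖ ≤ 1) ∧ ∀ n, 1 ≤ n →
      lamS * g (n + 1) * g n + (min n k : ℕ) * muS =
        (lamS + (min n k : ℕ) * muS + ξ) * g n := by
  obtain ⟨r, hr1, hr⟩ := exists_busy_root hlamS hlt hξ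
  -- The equations are solved downwards in `n`, with `j = k - n`. Truncated subtraction sends every
  -- `n ≥ k` to `j = 0`, where all servers are busy and the value is the root `r`; below that, the
  -- value at `n` follows from the one at `n + 1`.
  let h : ℕ → ℂ := fun j => Nat.rec r (fun j hj =>
    ((k - (j + 1) : ℕ) * muS) / (lamS + (k - (j + 1) : ℕ) * muS + ξ - lamS * hj)) j
  have hs : ∀ j, h (j + 1) = ((k - (j + 1) : ℕ) * muS) /
    (lamS + (k - (j + 1) : ℕ) * muS + ξ - lamS * h j) := fun j => rfl
  -- This bound on the denominator gives both norm at most one and, for `n ≥ 1`, nonvanishing.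
  have hden : ∀ (q : ℂ) (n : ℕ), ‖q‖ ≤ 1 → n * muS ≤ (lamS + n * muS + ξ - lamS * q).re := by
    intro q n hq
    have : q.re ≤ 1 := (Complex.re_le_norm q).trans hq
    simp
    nlinarith
  have hb : ∀ j, ‖h j‖ ≤ 1 := by
    intro j
    induction j with
    | zero => exact hr1
    | succ j ih =>
      rw [hs, norm_div]
      refine div_le_one_of_le₀ ?_ (norm_nonneg _)
      refine le_trans ?_ ((hden _ _ ih).trans (Complex.re_le_norm _))
      rw [norm_mul, Complex.norm_natCast, Complex.norm_of_nonneg hmuS.le]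
  refine ⟨fun n => h (k - n), fun n => hb _, fun n hn => ?_⟩
  simp only
  rcases le_or_gt k n with hkn | hkn
  · rw [min_eq_right hkn, Nat.sub_eq_zero_of_le hkn, Nat.sub_eq_zero_of_le (by omega)]
    have h0 : h 0 = r := rfl
    rw [h0]
    push_cast at hr
    linear_combination hr
  · rw [min_eq_left hkn.le]
    have e := hs (k - (n + 1))
    rw [show k - (n + 1) + 1 = k - n by omega, show k - (k - n) = n by omega] at e
    have hpos : 0 < n * muS := by positivity
    have hne : (lamS + n * muS + ξ - lamS * h (k - (n + 1)) : ℂ) ≠ 0 := by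
      intro h'
      have := hden (h (k - (n + 1))) n (hb _)
      rw [h', Complex.zero_re] at this
      linarith
    rw [eq_div_iff hne] at e
    linear_combination -e

/-- Transforms of the service times of the small jobs that remain in phase 4. -/
lemma exists_service_transform {muS : ℝ} (hmuS : 0 < muS) {ξ : ℂ} (hξ : 0 ≤ ξ.re) :
    ∃ e : ℕ → ℂ, (∀ n, ‖e n‖ ≤ 1) ∧ ∀ n, 1 ≤ n → (n * muS + ξ) * e n = n * muS := by
  have hden : ∀ n : ℕ, n * muS ≤ (n * muS + ξ : ℂ).re := fun n => by simpa using hξ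
  refine ⟨fun n => n * muS / (n * muS + ξ), fun n => ?_, fun n hn => ?_⟩
  · rw [norm_div]
    refine div_le_one_of_le₀ ?_ (norm_nonneg _)
    refine le_trans ?_ ((hden n).trans (Complex.re_le_norm _))
    rw [norm_mul, Complex.norm_natCast, Complex.norm_of_nonneg hmuS.le]
  · have hpos : 0 < n * muS := by positivity
    have hne : (n * muS + ξ : ℂ) ≠ 0 := by
      intro h'
      have := hden n
      rw [h', Complex.zero_re] at this
      linarith
    field_simp

/-- Increments of a Lyapunov function for the number of small jobs. -/
lemma exists_lyapunov_increment {k : ℕ} {lamS lamL muS : ℝ} (hlamS : 0 < lamS)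
    (hlamL : 0 < lamL) (hmuS : 0 < muS) (hlt : lamS < k * muS) :
    ∃ d : ℕ → ℝ, (∀ n, 0 ≤ d n) ∧ ∀ n, 1 ≤ n →
      lamS * d (n + 1) + (lamS + lamL + (min n k : ℕ) * muS) ≤ (min n k : ℕ) * muS * d n := by
  -- Again `j = k - n`. The value at `j = 0` is the constant solution for all servers busy, positive
  -- because `lamS < k * muS`; the other values solve the equation at `n` from the value at `n + 1`.
  let h : ℕ → ℝ := fun j => Nat.rec ((lamS + lamL + k * muS) / (k * muS - lamS)) (fun j hj =>
    (lamS * hj + (lamS + lamL + (k - (j + 1) : ℕ) * muS)) / ((k - (j + 1) : ℕ) * muS)) j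
  have hs : ∀ j, h (j + 1) = (lamS * h j + (lamS + lamL + (k - (j + 1) : ℕ) * muS)) /
    ((k - (j + 1) : ℕ) * muS) := fun j => rfl
  have h0 : h 0 = (lamS + lamL + k * muS) / (k * muS - lamS) := rfl
  have hb : ∀ j, 0 ≤ h j := by
    intro j
    induction j with
    | zero => rw [h0]; exact div_nonneg (by positivity) (by linarith)
    | succ j ih => rw [hs]; positivity
  refine ⟨fun n => h (k - n), fun n => hb _, fun n hn => le_of_eq ?_⟩
  simp only
  rcases le_or_gt k n with hkn | hkn
  · rw [min_eq_right hkn, Nat.sub_eq_zero_of_le hkn, Nat.sub_eq_zero_of_le (by omega), h0]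
    have : (k * muS - lamS : ℝ) ≠ 0 := by linarith
    field_simp
    ring
  · rw [min_eq_left hkn.le]
    have e := hs (k - (n + 1))
    rw [show k - (n + 1) + 1 = k - n by omega, show k - (k - n) = n by omega] at e
    have hpos : 0 < n * muS := by positivity
    rw [eq_div_iff hpos.ne'] at e
    linear_combination -e

/-! ### From the beginning of phase 2 to the beginning of phase 1 -/

/-- The states reached from a full beginning of phase 2 until phase 1 begins. -/
def serviceStates (k l : ℕ) : Set State := fun x =>
  match x.phase with
  | .two => k ≤ x.nS + 1 ∧ x.uS = min x.nS k ∧ x.uL = 0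
  | .three => l ≤ x.nS ∧ x.uS = min x.nS k ∧ x.uL = 0
  | .four => x.uS ≤ x.nS ∧ x.uL = 0
  | .one => x.uS = 0 ∧ x.uL = min x.nL 1

lemma mem_serviceStates {k l : ℕ} {x : State} : x ∈ serviceStates k l ↔
    match x.phase with
    | .two => k ≤ x.nS + 1 ∧ x.uS = min x.nS k ∧ x.uL = 0
    | .three => l ≤ x.nS ∧ x.uS = min x.nS k ∧ x.uL = 0
    | .four => x.uS ≤ x.nS ∧ x.uL = 0
    | .one => x.uS = 0 ∧ x.uL = min x.nL 1 := Iff.rfl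

/-- A small job departs in phase 2 only while `nS ≥ k`, and in phase 3 only while more than `l` are
in service, so neither level is undershot. The idling clause of phase 2 is out of reach because `k ≥
2` forces `nS ≥ 1`. -/
lemma invariant_serviceStates {k l : ℕ} (hk : 2 ≤ k) (hl : l < k) :
    Invariant k l {x | x.phase = .one} (serviceStates k l) := by
  rintro ⟨p, nS, nL, uS, uL⟩ hx hA
  rw [mem_serviceStates] at hx
  cases p <;> simp only [Set.mem_ofPred_eq, reduceCtorEq, not_false_eq_true, not_true_eq_false] at hA
  all_goals
    simp only [mem_serviceStates, State.PhaseOver, State.advance, State.arriveS, State.arriveL,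
      State.departS, State.departL, State.admit, Phase.next, and_true, implies_true, true_and, not_and] at hx ⊢
    omega

/-- The joint transform of the durations of the phases until phase 1 begins and of the numbers of
jobs then, as a function of the current state. -/
noncomputable def serviceFun (k l : ℕ) (y v r : ℂ) (g e : ℕ → ℂ) (x : State) : ℂ :=
  match x.phase with
  | .one => y ^ x.nL * v ^ x.nS
  | .four => y ^ x.nL * v ^ (x.nS - x.uS) * ∏ i ∈ Finset.Icc 1 x.uS, e i
  | .three => y ^ x.nL * (∏ i ∈ Finset.Ioc l x.nS, g i) * ∏ i ∈ Finset.Icc 1 l, e i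
  | .two => y ^ x.nL * r ^ (x.nS + 1 - k) * (∏ i ∈ Finset.Ioc l (k - 1), g i) *
      ∏ i ∈ Finset.Icc 1 l, e i

lemma norm_mul_le_one {a b : ℂ} (ha : ‖a‖ ≤ 1) (hb : ‖b‖ ≤ 1) : ‖a * b‖ ≤ 1 := by
  rw [norm_mul]; exact mul_le_one₀ ha (norm_nonneg _) hb

lemma norm_pow_le_one {a : ℂ} (ha : ‖a‖ ≤ 1) (n : ℕ) : ‖a ^ n‖ ≤ 1 := by
  rw [norm_pow]; exact pow_le_one₀ (norm_nonneg _) ha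

lemma norm_prod_le_one {g : ℕ → ℂ} (hg : ∀ n, ‖g n‖ ≤ 1) (s : Finset ℕ) : ‖∏ i ∈ s, g i‖ ≤ 1 := by
  rw [norm_prod]; exact Finset.prod_le_one (fun _ _ => norm_nonneg _) fun i _ => hg i

lemma norm_serviceFun_le (k l : ℕ) {y v r : ℂ} {g e : ℕ → ℂ} (hy : ‖y‖ ≤ 1) (hv : ‖v‖ ≤ 1)
    (hr : ‖r‖ ≤ 1) (hg : ∀ n, ‖g n‖ ≤ 1) (he : ∀ n, ‖e n‖ ≤ 1) (x : State) :
    ‖serviceFun k l y v r g e x‖ ≤ 1 := by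
  unfold serviceFun
  split
  · exact norm_mul_le_one (norm_pow_le_one hy _) (norm_pow_le_one hv _)
  · exact norm_mul_le_one (norm_mul_le_one (norm_pow_le_one hy _) (norm_pow_le_one hv _))
      (norm_prod_le_one he _)
  · exact norm_mul_le_one (norm_mul_le_one (norm_pow_le_one hy _) (norm_prod_le_one hg _))
      (norm_prod_le_one he _)
  · exact norm_mul_le_one (norm_mul_le_one (norm_mul_le_one (norm_pow_le_one hy _)
      (norm_pow_le_one hr _)) (norm_prod_le_one hg _)) (norm_prod_le_one he _)

/-- Phase changes take no time, so the pieces of `serviceFun` must agree at the states where a phase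
ends. They do because phase 2 ends at `k - 1` and phase 3 at `l` with nobody waiting. -/
lemma serviceFun_advance {k l : ℕ} (hk : 2 ≤ k) (hl : l < k) (y v r : ℂ) (g e : ℕ → ℂ) {x : State}
    (hx : x ∈ serviceStates k l) (hA : x.phase ≠ .one) (ho : x.PhaseOver k l) :
    serviceFun k l y v r g e (x.advance k) = serviceFun k l y v r g e x := by
  obtain ⟨p, nS, nL, uS, uL⟩ := x
  rw [mem_serviceStates] at hx
  cases p <;> simp only [State.PhaseOver, ne_eq, reduceCtorEq, not_false_eq_true,
    not_true_eq_false] at hx ho hA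
  · obtain rfl : nS = k - 1 := by omega
    simp only [serviceFun, State.advance, State.admit, Phase.next]
    rw [show k - 1 + 1 - k = 0 by omega]
    simp
  · obtain rfl : nS = l := by omega
    obtain rfl : uS = nS := by omega
    simp [serviceFun, State.advance, State.admit, Phase.next]
  · subst ho
    simp [serviceFun, State.advance, State.admit, Phase.next]

/-- A large arrival multiplies the function by `y`, so its contribution moves into the discount as
`lamL * (1 - y)`. What remains is the first-step equation of one downward passage: `hr` in phase 2,
`hg` in phase 3, `he` in phase 4. In phase 4 a small arrival only waits and multiplies by `v`, which
adds `lamS * (1 - v)`. -/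
lemma serviceFun_harmonic {k l : ℕ} {lamS lamL muS muL : ℝ} (hk : 2 ≤ k) (hl : l < k)
    {y v r : ℂ} {g e : ℕ → ℂ} {σ : Phase → ℂ}
    (hr : lamS * r ^ 2 + (k * muS : ℝ) =
      (lamS + (k * muS : ℝ) + (σ .two + lamL * (1 - y))) * r)
    (hg : ∀ n, 1 ≤ n → lamS * g (n + 1) * g n + (min n k : ℕ) * muS =
      (lamS + (min n k : ℕ) * muS + (σ .three + lamL * (1 - y))) * g n)
    (he : ∀ n, 1 ≤ n → (n * muS + (σ .four + lamL * (1 - y) + lamS * (1 - v))) * e n = n * muS)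
    {x : State} (hx : x ∈ serviceStates k l) (hA : x.phase ≠ .one) (ho : ¬ x.PhaseOver k l) :
    lamS * serviceFun k l y v r g e (x.arriveS k) + lamL * serviceFun k l y v r g e (x.arriveL k) +
      x.uS * muS * serviceFun k l y v r g e (x.departS k) +
      x.uL * muL * serviceFun k l y v r g e (x.departL k) =
      (lamS + lamL + x.uS * muS + x.uL * muL + σ x.phase) * serviceFun k l y v r g e x := by
  obtain ⟨p, nS, nL, uS, uL⟩ := x
  rw [mem_serviceStates] at hx
  cases p <;> simp only [State.PhaseOver, ne_eq, reduceCtorEq, not_false_eq_true,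
    not_true_eq_false] at hx ho hA
  · obtain ⟨m, rfl⟩ : ∃ m, nS = k + m := ⟨nS - k, by omega⟩
    obtain ⟨-, rfl, rfl⟩ := hx
    rw [min_eq_right (by omega)]
    simp only [serviceFun, State.arriveS, State.arriveL, State.departS, State.departL, State.admit]
    rw [show k + m + 1 + 1 - k = m + 2 by omega, show k + m + 1 - k = m + 1 by omega,
      show k + m - 1 + 1 - k = m by omega]
    push_cast at hr ⊢
    linear_combination (y ^ nL * r ^ m * (∏ i ∈ Finset.Ioc l (k - 1), g i) *
      ∏ i ∈ Finset.Icc 1 l, e i) * hr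
  · obtain ⟨m, rfl⟩ : ∃ m, nS = m + 1 := ⟨nS - 1, by omega⟩
    obtain ⟨-, rfl, rfl⟩ := hx
    have := hg (m + 1) (by omega)
    simp only [serviceFun, State.arriveS, State.arriveL, State.departS, State.departL, State.admit,
      Nat.add_sub_cancel]
    rw [Finset.prod_Ioc_succ_top (show l ≤ m + 1 by omega),
      Finset.prod_Ioc_succ_top (show l ≤ m by omega)]
    linear_combination (y ^ nL * (∏ i ∈ Finset.Ioc l m, g i) *
      ∏ i ∈ Finset.Icc 1 l, e i) * this
  · obtain ⟨m, rfl⟩ : ∃ m, uS = m + 1 := ⟨uS - 1, by omega⟩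
    obtain ⟨hle, rfl⟩ := hx
    obtain ⟨j, rfl⟩ : ∃ j, nS = m + 1 + j := ⟨nS - (m + 1), by omega⟩
    have := he (m + 1) (by omega)
    simp only [serviceFun, State.arriveS, State.arriveL, State.departS, State.departL, State.admit,
      Nat.add_sub_cancel]
    rw [Finset.prod_Icc_succ_top (by omega), show m + 1 + j + 1 - (m + 1) = j + 1 by omega,
      show m + 1 + j - (m + 1) = j by omega, show m + 1 + j - 1 - m = j by omega]
    push_cast at this ⊢
    linear_combination (-(y ^ nL * v ^ j * (∏ i ∈ Finset.Icc 1 m, e i))) * this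

section Run

variable {k l : ℕ} {lamS lamL muS muL : ℝ} {Ω : Type*} [MeasurableSpace Ω] {P : Measure Ω}
  [IsFiniteMeasure P] {X : ℕ → Ω → State} {T : ℕ → Ω → ℝ}

/-- Phases 2, 3 and 4 come to an end. -/
lemma IsRun.ae_exists_phase_one (h : IsRun k l lamS lamL muS muL P X T) (hk : 2 ≤ k) (hl : l < k)
    (hlamS : 0 < lamS) (hlamL : 0 < lamL) (hmuS : 0 < muS) (hmuL : 0 < muL)
    (hlt : lamS < k * muS) (h0 : ∀ᵐ ω ∂P, X 0 ω ∈ serviceStates k l) :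
    ∀ᵐ ω ∂P, ∃ n, (X n ω).phase = .one := by
  obtain ⟨d, hd0, hd⟩ := exists_lyapunov_increment hlamS hlamL hmuS hlt
  -- With `n ≥ 1` jobs in service in phase 4, the downward drift `n * muS * c` is then at least the
  -- total rate `lamS + lamL + n * muS`.
  set c : ℝ := (lamS + lamL + muS) / muS with hc
  have hc0 : 0 ≤ c := by positivity
  have hcm : c * muS = lamS + lamL + muS := div_mul_cancel₀ _ hmuS.ne'
  -- The constants 0, 1, 2, 3 descend along the phases so that each instantaneous phase change also
  -- lowers the function by one.
  let v : State → ℝ := fun x =>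
    match x.phase with
    | .one => 0
    | .four => 1 + x.uS * c
    | .three => 2 + l * c + ∑ i ∈ Finset.Ioc l x.nS, d i
    | .two => 3 + l * c + ∑ i ∈ Finset.Ioc l x.nS, d i
  have hv : ∀ x, 0 ≤ v x := by
    intro x
    simp only [v]
    have : 0 ≤ ∑ i ∈ Finset.Ioc l x.nS, d i := Finset.sum_nonneg fun i _ => hd0 i
    split <;> positivity
  refine h.ae_exists_mem hlamS hlamL hmuS hmuL (invariant_serviceStates hk hl) hv ?_ ?_ h0
  · rintro ⟨p, nS, nL, uS, uL⟩ hx hA ho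
    rw [mem_serviceStates] at hx
    cases p <;> simp only [State.PhaseOver, Set.mem_ofPred_eq, reduceCtorEq, not_false_eq_true,
      not_true_eq_false] at hx ho hA
    · simp only [v, State.advance, State.admit, Phase.next]
      linarith
    · obtain rfl : nS = l := by omega
      obtain rfl : uS = nS := by omega
      simp only [v, State.advance, State.admit, Phase.next, Finset.Ioc_self, Finset.sum_empty]
      linarith
    · subst ho
      simp [v, State.advance, State.admit, Phase.next]
  · rintro ⟨p, nS, nL, uS, uL⟩ hx hA ho
    rw [mem_serviceStates] at hx
    cases p <;> simp only [State.PhaseOver, Set.mem_ofPred_eq, reduceCtorEq, not_false_eq_true,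
      not_true_eq_false] at hx ho hA
    · obtain ⟨m, rfl⟩ : ∃ m, nS = m + 1 := ⟨nS - 1, by omega⟩
      obtain ⟨-, rfl, rfl⟩ := hx
      have := hd (m + 1) (by omega)
      simp only [v, State.arriveS, State.arriveL, State.departS, State.departL, State.admit,
        Nat.add_sub_cancel]
      rw [Finset.sum_Ioc_succ_top (show l ≤ m + 1 by omega),
        Finset.sum_Ioc_succ_top (show l ≤ m by omega)]
      push_cast at this ⊢
      linarith
    · obtain ⟨m, rfl⟩ : ∃ m, nS = m + 1 := ⟨nS - 1, by omega⟩
      obtain ⟨-, rfl, rfl⟩ := hx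
      have := hd (m + 1) (by omega)
      simp only [v, State.arriveS, State.arriveL, State.departS, State.departL, State.admit,
        Nat.add_sub_cancel]
      rw [Finset.sum_Ioc_succ_top (show l ≤ m + 1 by omega),
        Finset.sum_Ioc_succ_top (show l ≤ m by omega)]
      push_cast at this ⊢
      linarith
    · obtain ⟨m, rfl⟩ : ∃ m, uS = m + 1 := ⟨uS - 1, by omega⟩
      obtain ⟨-, rfl⟩ := hx
      simp only [v, State.arriveS, State.arriveL, State.departS, State.departL, State.admit,
        Nat.add_sub_cancel]
      have hm : (0 : ℝ) ≤ m := Nat.cast_nonneg m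
      push_cast
      nlinarith [mul_nonneg hm hlamS.le, mul_nonneg hm hlamL.le]

/-! ### Phase 1 -/

/-- The states of phase 1, and phase 2. -/
def largeStates : Set State :=
  {x | (x.phase = .one ∧ x.uS = 0 ∧ x.uL = min x.nL 1) ∨ x.phase = .two}

omit [MeasurableSpace Ω] in
lemma invariant_largeStates (k l : ℕ) : Invariant k l {x | x.phase = .two} largeStates := by
  rintro ⟨p, nS, nL, uS, uL⟩ hx hA
  cases p <;> simp only [Set.mem_ofPred_eq, reduceCtorEq, not_false_eq_true,
    not_true_eq_false] at hA
  all_goals simp [largeStates] at hx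
  simp only [largeStates, State.PhaseOver, State.advance, State.arriveS, State.arriveL,
      State.departS, State.departL, State.admit, Phase.next, Set.mem_ofPred_eq]
  simp [hx.1]

lemma IsRun.ae_exists_phase_two (h : IsRun k l lamS lamL muS muL P X T)
    (hlamS : 0 < lamS) (hlamL : 0 < lamL) (hmuS : 0 < muS) (hmuL : 0 < muL)
    (hlt : lamL < muL) (h0 : ∀ᵐ ω ∂P, X 0 ω ∈ largeStates) :
    ∀ᵐ ω ∂P, ∃ n, (X n ω).phase = .two := by
  -- Chosen so that the drift in the number of large jobs compensates the total event rate of phase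
  -- 1.
  set d : ℝ := (lamS + lamL + muL) / (muL - lamL) with hd
  have hd0 : 0 ≤ d := div_nonneg (by linarith) (by linarith)
  have hdm : d * (muL - lamL) = lamS + lamL + muL := div_mul_cancel₀ _ (by linarith)
  let v : State → ℝ := fun x => if x.phase = .one then 1 + x.nL * d else 0
  have hv : ∀ x, 0 ≤ v x := by
    intro x
    simp only [v]
    split_ifs <;> positivity
  refine h.ae_exists_mem hlamS hlamL hmuS hmuL (invariant_largeStates k l) hv ?_ ?_ h0
  · rintro ⟨p, nS, nL, uS, uL⟩ hx hA ho
    cases p <;> simp [largeStates] at hx hA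
    simp only [State.PhaseOver] at ho
    simp [v, State.advance, State.admit, Phase.next, ho]
  · rintro ⟨p, nS, nL, uS, uL⟩ hx hA ho
    cases p <;> simp [largeStates] at hx hA
    simp only [State.PhaseOver] at ho
    obtain ⟨m, rfl⟩ : ∃ m, nL = m + 1 := ⟨nL - 1, by omega⟩
    obtain ⟨rfl, rfl⟩ := hx
    simp [v, State.arriveS, State.arriveL, State.departS, State.departL, State.admit]
    linarith

/-- The number of small jobs at the end of phase 1. -/
lemma IsRun.integral_phase_two (h : IsRun k l lamS lamL muS muL P X T)
    (hlamS : 0 < lamS) (hlamL : 0 < lamL) (hmuS : 0 < muS) (hmuL : 0 < muL)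
    (hlt : lamL < muL) (h0 : ∀ᵐ ω ∂P, X 0 ω ∈ largeStates) {z r : ℂ} (hz : ‖z‖ ≤ 1) (hr1 : ‖r‖ ≤ 1)
    (hr : lamL * r ^ 2 + muL = (lamL + muL + lamS * (1 - z)) * r)
    (hp0 : ∀ᵐ ω ∂P, (X 0 ω).phase = .one) :
    ∫ ω, z ^ (X (sInf {n | (X n ω).phase = .two}) ω).nS ∂P =
      ∫ ω, r ^ (X 0 ω).nL * z ^ (X 0 ω).nS ∂P := by
  have hit := h.ae_exists_phase_two hlamS hlamL hmuS hmuL hlt h0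
  -- Time is not discounted here. The term `lamS * (1 - z)` in the equation for `r` comes from the
  -- small arrivals, each of which multiplies the function by `z`. The two branches agree at the end
  -- of phase 1, where `nL = 0`.
  have key := h.integral_optional_stopping hlamS hlamL hmuS hmuL (invariant_largeStates k l)
    (σ := fun _ => 0) (fun _ => le_rfl)
    (f := fun x => if x.phase = .one then r ^ x.nL * z ^ x.nS else z ^ x.nS) ?_ ?_ ?_ h0 hit
  · have e : ∫ ω, (if (X 0 ω).phase = .one then r ^ (X 0 ω).nL * z ^ (X 0 ω).nS else
        z ^ (X 0 ω).nS) ∂P = ∫ ω, r ^ (X 0 ω).nL * z ^ (X 0 ω).nS ∂P :=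
      integral_congr_ae (hp0.mono fun ω hω => by simp only [hω, if_true])
    rw [← e, ← key]
    refine integral_congr_ae (hit.mono fun ω hω => ?_)
    have : (X (sInf {n | (X n ω).phase = .two}) ω).phase = .two := Nat.sInf_mem hω
    simp only [Set.mem_ofPred_eq, this]
    simp
  · intro x
    split_ifs
    · exact norm_mul_le_one (norm_pow_le_one hr1 _) (norm_pow_le_one hz _)
    · exact norm_pow_le_one hz _
  · rintro ⟨p, nS, nL, uS, uL⟩ hx hA ho
    cases p <;> simp [largeStates] at hx hA
    simp only [State.PhaseOver] at ho
    simp [State.advance, State.admit, Phase.next, ho]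
  · rintro ⟨p, nS, nL, uS, uL⟩ hx hA ho
    cases p <;> simp [largeStates] at hx hA
    simp only [State.PhaseOver] at ho
    obtain ⟨m, rfl⟩ : ∃ m, nL = m + 1 := ⟨nL - 1, by omega⟩
    obtain ⟨rfl, rfl⟩ := hx
    simp [State.arriveS, State.arriveL, State.departS, State.departL, State.admit]
    linear_combination (r ^ m * z ^ nS) * hr

end Run

/-! ### The phases along a path -/

section Path

variable {Ω : Type*} {X : ℕ → Ω → State} {T : ℕ → Ω → ℝ} {ω : Ω}

/-- The phase can only stay or move to its successor, so the first departure from `q` is the first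
visit to `q.next`. -/
lemma firstFrom_next (hstep : ∀ i, (X (i + 1) ω).phase = (X i ω).phase ∨
      (X (i + 1) ω).phase = (X i ω).phase.next) {q : Phase} {m : ℕ} (hm : (X m ω).phase = q)
    (hex : ∃ M, m ≤ M ∧ (X M ω).phase ≠ q) :
    m ≤ firstFrom X q.next m ω ∧ (X (firstFrom X q.next m ω) ω).phase = q.next ∧
      ∀ i, m ≤ i → i < firstFrom X q.next m ω → (X i ω).phase = q := by
  classical
  have hq : q.next ≠ q := by cases q <;> simp [Phase.next]
  obtain ⟨h1, h2⟩ := Nat.find_spec hex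
  have hmin : ∀ i, m ≤ i → i < Nat.find hex → (X i ω).phase = q := by
    intro i hi hlt
    by_contra h
    exact Nat.find_min hex hlt ⟨hi, h⟩
  have hlt : m < Nat.find hex := lt_of_le_of_ne h1 fun h => h2 (by rw [← h, hm])
  have hnext : (X (Nat.find hex) ω).phase = q.next := by
    have hs := hstep (Nat.find hex - 1)
    rw [Nat.sub_add_cancel (by omega), hmin (Nat.find hex - 1) (by omega) (by omega)] at hs
    exact hs.resolve_left h2
  have heq : firstFrom X q.next m ω = Nat.find hex := by
    refine le_antisymm (Nat.sInf_le ⟨h1, hnext⟩) ?_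
    refine Nat.find_min' hex ?_
    have := Nat.sInf_mem (s := {n | m ≤ n ∧ (X n ω).phase = q.next}) ⟨_, h1, hnext⟩
    exact ⟨this.1, fun h => hq (this.2.symm.trans h)⟩
  rw [heq]
  exact ⟨h1, hnext, hmin⟩

lemma firstFrom_eq_add {p : Phase} {m : ℕ} (hex : ∃ i, (X (m + i) ω).phase = p) :
    firstFrom X p m ω = m + sInf {i | (X (m + i) ω).phase = p} := by
  have h1 : (X (m + sInf {i | (X (m + i) ω).phase = p}) ω).phase = p := Nat.sInf_mem hex
  refine le_antisymm (Nat.sInf_le ⟨Nat.le_add_right _ _, h1⟩) ?_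
  obtain ⟨h2, h3⟩ := Nat.sInf_mem (s := {n | m ≤ n ∧ (X n ω).phase = p})
    ⟨_, Nat.le_add_right _ _, h1⟩
  have h2' : m ≤ firstFrom X p m ω := h2
  have : sInf {i | (X (m + i) ω).phase = p} ≤ firstFrom X p m ω - m := by
    refine Nat.sInf_le ?_
    rw [Set.mem_ofPred_eq, Nat.add_sub_cancel' h2']
    exact h3
  omega

/-- An earlier beginning is counted among the predecessors of a later one, so the two cannot carry
the same cycle number. -/
lemma CycleBegins.lt_irrefl {c n n' : ℕ} (h : CycleBegins X c ω n) (h' : CycleBegins X c ω n') :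
    ¬ n < n' := by
  intro hlt
  have hfin : {m | m < n' ∧ BeginsTwo X ω m}.Finite :=
    (Set.finite_lt_nat n').subset fun m hm => hm.1
  have : {m | m < n ∧ BeginsTwo X ω m} ⊂ {m | m < n' ∧ BeginsTwo X ω m} := by
    refine ⟨fun m hm => ⟨hm.1.trans hlt, hm.2⟩, fun hsub => ?_⟩
    exact absurd (hsub ⟨hlt, h.1⟩).1 (Nat.lt_irrefl _)
  have := Set.ncard_lt_ncard this hfin
  rw [h.2, h'.2] at this
  exact Nat.lt_irrefl _ this

lemma CycleBegins.start2_eq {c n : ℕ} (h : CycleBegins X c ω n) : start2 X c ω = n := by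
  have h' : CycleBegins X c ω (start2 X c ω) := Nat.sInf_mem (s := {n | CycleBegins X c ω n}) ⟨n, h⟩
  have h1 := h.lt_irrefl h'
  have h2 := h'.lt_irrefl h
  omega

lemma cycleBegins_start2 {k c : ℕ} (h : ω ∈ fullStart X k c) :
    CycleBegins X c ω (start2 X c ω) ∧ k ≤ (X (start2 X c ω) ω).nS := by
  obtain ⟨n, hn, hk⟩ := h
  rw [hn.start2_eq]
  exact ⟨hn, hk⟩

lemma cycleBegins_congr {ω' : Ω} {c n : ℕ} (h : ∀ i ≤ n, X i ω = X i ω')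
    (hc : CycleBegins X c ω n) : CycleBegins X c ω' n := by
  have hb : ∀ m ≤ n, (BeginsTwo X ω m ↔ BeginsTwo X ω' m) := by
    intro m hm
    unfold BeginsTwo
    rw [h m hm, h (m - 1) (by omega)]
  refine ⟨(hb n le_rfl).1 hc.1, ?_⟩
  rw [← hc.2]
  congr 1
  ext m
  exact and_congr_right fun hm => (hb m hm.le).symm

/-- The stopping-time property of the beginning of the cycle: its number and its small-job count are
visible from the path up to that step. -/
lemma dependsOn_fullStart (k c n : ℕ) :
    DependsOn X n (fullStart X k c ∩ {ω | start2 X c ω = n}) := by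
  rintro ω ω' h ⟨h1, rfl⟩
  obtain ⟨h2, h3⟩ := cycleBegins_start2 h1
  have h4 := cycleBegins_congr h h2
  exact ⟨⟨_, h4, by rwa [← h _ le_rfl]⟩, h4.start2_eq⟩

variable (c : ℕ) (hstep : ∀ i, (X (i + 1) ω).phase = (X i ω).phase ∨
      (X (i + 1) ω).phase = (X i ω).phase.next) (h2 : (X (start2 X c ω) ω).phase = .two)
    (h1 : ∃ i, (X (start2 X c ω + i) ω).phase = .one)

include hstep h2 h1

lemma start_spec :
    (start2 X c ω ≤ start3 X c ω ∧ start3 X c ω ≤ start4 X c ω ∧ start4 X c ω ≤ start1 X c ω) ∧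
    ((X (start3 X c ω) ω).phase = .three ∧ (X (start4 X c ω) ω).phase = .four ∧
      (X (start1 X c ω) ω).phase = .one) ∧
    (∀ i, start2 X c ω ≤ i → i < start3 X c ω → (X i ω).phase = .two) ∧
    (∀ i, start3 X c ω ≤ i → i < start4 X c ω → (X i ω).phase = .three) ∧
    (∀ i, start4 X c ω ≤ i → i < start1 X c ω → (X i ω).phase = .four) := by
  obtain ⟨j, hj⟩ := h1
  obtain ⟨a1, a2, a3⟩ := firstFrom_next hstep h2 ⟨_, Nat.le_add_right _ j, by simp [hj]⟩
  change start2 X c ω ≤ start3 X c ω at a1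
  change (X (start3 X c ω) ω).phase = .three at a2
  change ∀ i, start2 X c ω ≤ i → i < start3 X c ω → _ at a3
  have hj3 : start3 X c ω ≤ start2 X c ω + j := by
    by_contra h
    have := a3 _ (Nat.le_add_right _ j) (not_le.1 h)
    simp [hj] at this
  obtain ⟨b1, b2, b3⟩ := firstFrom_next hstep a2 ⟨_, hj3, by simp [hj]⟩
  change start3 X c ω ≤ start4 X c ω at b1
  change (X (start4 X c ω) ω).phase = .four at b2
  change ∀ i, start3 X c ω ≤ i → i < start4 X c ω → _ at b3
  have hj4 : start4 X c ω ≤ start2 X c ω + j := by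
    by_contra h
    have := b3 _ hj3 (not_le.1 h)
    simp [hj] at this
  obtain ⟨c1, c2, c3⟩ := firstFrom_next hstep b2 ⟨_, hj4, by simp [hj]⟩
  exact ⟨⟨a1, b1, c1⟩, ⟨a2, b2, c2⟩, a3, b3, c3⟩

/-- The nested definition of `start1` through phases 3 and 4 agrees with the plain first visit to
phase 1, since only phases 2, 3, 4 occur in between. This is the hitting time that optional stopping
uses. -/
lemma start1_eq_add :
    start1 X c ω = start2 X c ω + sInf {i | (X (start2 X c ω + i) ω).phase = .one} := by
  obtain ⟨⟨a1, a2, a3⟩, ⟨b2, b3, b4⟩, c2, c3, c4⟩ := start_spec c hstep h2 h1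
  rw [← firstFrom_eq_add h1]
  refine le_antisymm ?_ (Nat.sInf_le ⟨by omega, b4⟩)
  obtain ⟨d1, d2⟩ := Nat.sInf_mem (s := {n | start2 X c ω ≤ n ∧ (X n ω).phase = .one})
    ⟨_, by omega, b4⟩
  change start2 X c ω ≤ firstFrom X .one (start2 X c ω) ω at d1
  change (X (firstFrom X .one (start2 X c ω) ω) ω).phase = .one at d2
  by_contra hlt
  push Not at hlt
  rcases lt_or_ge (firstFrom X .one (start2 X c ω) ω) (start3 X c ω) with h | h
  · simp [c2 _ d1 h] at d2
  rcases lt_or_ge (firstFrom X .one (start2 X c ω) ω) (start4 X c ω) with h' | h'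
  · simp [c3 _ h h'] at d2
  · simp [c4 _ h' hlt] at d2

lemma prod_exp_eq (σ : Phase → ℂ) :
    ∏ i ∈ Finset.range (sInf {i | (X (start2 X c ω + i) ω).phase = .one}),
      Complex.exp (-σ (X (start2 X c ω + i) ω).phase * (T (start2 X c ω + i) ω : ℂ)) =
    Complex.exp (-σ .two * (H2 X T c ω : ℂ)) * Complex.exp (-σ .three * (H3 X T c ω : ℂ)) *
      Complex.exp (-σ .four * (H4 X T c ω : ℂ)) := by
  obtain ⟨⟨a1, a2, a3⟩, -, c2, c3, c4⟩ := start_spec c hstep h2 h1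
  have e := start1_eq_add c hstep h2 h1
  have e' : sInf {i | (X (start2 X c ω + i) ω).phase = .one} = start1 X c ω - start2 X c ω := by
    omega
  rw [e', ← Finset.prod_Ico_eq_prod_range
      (fun i => Complex.exp (-σ (X i ω).phase * (T i ω : ℂ))),
    ← Finset.prod_Ico_consecutive _ (a1.trans a2) a3, ← Finset.prod_Ico_consecutive _ a1 a2,
    ← Complex.exp_sum, ← Complex.exp_sum, ← Complex.exp_sum]
  have key : ∀ (a b : ℕ) (p : Phase), (∀ i, a ≤ i → i < b → (X i ω).phase = p) →
      ∑ i ∈ Finset.Ico a b, -σ (X i ω).phase * (T i ω : ℂ) =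
        -σ p * ((∑ i ∈ Finset.Ico a b, T i ω : ℝ) : ℂ) := by
    intro a b p h
    push_cast
    rw [Finset.mul_sum]
    refine Finset.sum_congr rfl fun i hi => ?_
    rw [Finset.mem_Ico] at hi
    rw [h i hi.1 hi.2]
  rw [key _ _ _ c2, key _ _ _ c3, key _ _ _ c4]
  rfl

end Path

/-! ### The cycle under the conditional law -/

/-- Both sides of `law` scale with `P`; conditioning, a restriction followed by normalization,
therefore keeps the jump-process property. -/
lemma IsJumpProcess.smul {S Ω : Type*} [MeasurableSpace Ω] {hold : S → Measure ℝ}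
    {jump : S → S → ENNReal} {P : Measure Ω} {X : ℕ → Ω → S} {T : ℕ → Ω → ℝ}
    (h : IsJumpProcess hold jump P X T) (a : ENNReal) : IsJumpProcess hold jump (a • P) X T where
  measurable_state := h.measurable_state
  measurable_time := h.measurable_time
  law n x B hB := by
    rw [Measure.smul_apply, Measure.smul_apply, h.law n x B hB, smul_eq_mul, smul_eq_mul, mul_assoc]

lemma re_mul_one_sub_nonneg {a : ℝ} (ha : 0 ≤ a) {y : ℂ} (hy : ‖y‖ ≤ 1) :
    0 ≤ ((a : ℂ) * (1 - y)).re := by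
  have : y.re ≤ 1 := (Complex.re_le_norm y).trans hy
  simp
  nlinarith

section Cycle

variable {k l : ℕ} {lamS lamL muS muL : ℝ} {Ω : Type*} [MeasurableSpace Ω] {P : Measure Ω}
  [IsProbabilityMeasure P] {X : ℕ → Ω → State} {T : ℕ → Ω → ℝ} {c : ℕ}

open Classical in
/-- The step at which phase 2 of a cycle with a full start begins. -/
noncomputable def fullStartStep (X : ℕ → Ω → State) (k c : ℕ) (ω : Ω) : ℕ :=
  if ω ∈ fullStart X k c then start2 X c ω else 0

omit [IsProbabilityMeasure P] in
lemma IsRun.shift_fullStart (h : IsRun k l lamS lamL muS muL P X T)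
    (hlamS : 0 < lamS) (hlamL : 0 < lamL) (hmuS : 0 < muS) (hmuL : 0 < muL) :
    MeasurableSet (fullStart X k c) ∧ IsRun k l lamS lamL muS muL (cond P (fullStart X k c))
      (fun i ω => X (fullStartStep X k c ω + i) ω) (fun i ω => T (fullStartStep X k c ω + i) ω) := by
  have := isProbabilityMeasure_holdLaw (k := k) (l := l) hlamS hlamL hmuS hmuL
  obtain ⟨h1, h2⟩ := IsJumpProcess.shift h (F := fullStart X k c) (N := fullStartStep X k c)
    (fun n => by
      have : fullStart X k c ∩ {ω | fullStartStep X k c ω = n} =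
          fullStart X k c ∩ {ω | start2 X c ω = n} := by
        ext ω
        exact and_congr_right fun hω => by simp [fullStartStep, hω]
      rw [this]
      exact dependsOn_fullStart k c n)
    (fun ω hω => if_neg hω)
  exact ⟨h1, h2.smul _⟩

omit [IsProbabilityMeasure P] in
lemma IsRun.ae_fullStart (h : IsRun k l lamS lamL muS muL P X T)
    (hlamS : 0 < lamS) (hlamL : 0 < lamL) (hmuS : 0 < muS) (hmuL : 0 < muL) :
    ∀ᵐ ω ∂cond P (fullStart X k c), fullStartStep X k c ω = start2 X c ω ∧
      CycleBegins X c ω (start2 X c ω) ∧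
      (∀ i, (X (i + 1) ω).phase = (X i ω).phase ∨ (X (i + 1) ω).phase = (X i ω).phase.next) ∧
      (X (start2 X c ω) ω).phase = .two ∧ k ≤ (X (start2 X c ω) ω).nS ∧
      (X (start2 X c ω) ω).nL = 0 ∧ (X (start2 X c ω) ω).uS = min (X (start2 X c ω) ω).nS k ∧
      (X (start2 X c ω) ω).uL = 0 := by
  have := isProbabilityMeasure_holdLaw (k := k) (l := l) hlamS hlamL hmuS hmuL
  have hF := (h.shift_fullStart (c := c) hlamS hlamL hmuS hmuL).1
  have hs := cond_absolutelyContinuous (s := fullStart X k c) (μ := P)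
    |>.ae_le (IsJumpProcess.ae_step h (Q := fun _ _ => True) fun _ => by simp)
  filter_upwards [hs, ae_cond_mem hF] with ω h1 h2
  obtain ⟨h3, h4⟩ := cycleBegins_start2 h2
  -- The transition from phase 1 into the phase 2 of the cycle; the clause `0 < n` of `BeginsTwo`
  -- ensures that it exists.
  have h5 := (h1 (start2 X c ω - 1)).1
  rw [Nat.sub_add_cancel h3.1.1] at h5
  exact ⟨if_pos h2, h3, fun i => phase_step (h1 i).1, h3.1.2.2, h4,
    step_one_two h5 h3.1.2.1 h3.1.2.2⟩

omit [IsProbabilityMeasure P] in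
lemma IsRun.ae_start_mem (h : IsRun k l lamS lamL muS muL P X T)
    (hlamS : 0 < lamS) (hlamL : 0 < lamL) (hmuS : 0 < muS) (hmuL : 0 < muL) :
    ∀ᵐ ω ∂cond P (fullStart X k c), X (fullStartStep X k c ω + 0) ω ∈ serviceStates k l := by
  filter_upwards [h.ae_fullStart (c := c) hlamS hlamL hmuS hmuL] with ω hω
  obtain ⟨h1, -, -, h2, h3, h4, h5, h6⟩ := hω
  rw [h1, Nat.add_zero, mem_serviceStates, h2]
  exact ⟨by omega, h5, h6⟩

lemma IsRun.ae_hits_one (h : IsRun k l lamS lamL muS muL P X T) (hk : 2 ≤ k) (hl : l < k)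
    (hlamS : 0 < lamS) (hlamL : 0 < lamL) (hmuS : 0 < muS) (hmuL : 0 < muL)
    (hlt : lamS < k * muS) (hc : P (fullStart X k c) ≠ 0) :
    ∀ᵐ ω ∂cond P (fullStart X k c), ∃ n, (X (fullStartStep X k c ω + n) ω).phase = .one := by
  have := cond_isProbabilityMeasure hc
  exact (h.shift_fullStart (c := c) hlamS hlamL hmuS hmuL).2.ae_exists_phase_one hk hl hlamS hlamL
    hmuS hmuL hlt (h.ae_start_mem hlamS hlamL hmuS hmuL)

/-- The joint transform of the durations of phases 2, 3, 4 and of the numbers of jobs at the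
beginning of phase 1. -/
theorem IsRun.exists_cycle_transform (h : IsRun k l lamS lamL muS muL P X T) (hk : 2 ≤ k)
    (hl : l < k) (hlamS : 0 < lamS) (hlamL : 0 < lamL) (hmuS : 0 < muS) (hmuL : 0 < muL)
    (hlt : lamS < k * muS) (hc : P (fullStart X k c) ≠ 0) :
    ∃ A B C : ℂ → ℂ, ∀ s₂ s₃ s₄ y v : ℂ, 0 ≤ s₂.re → 0 ≤ s₃.re → 0 ≤ s₄.re → ‖y‖ ≤ 1 → ‖v‖ ≤ 1 →
      ∫ ω, Complex.exp (-s₂ * (H2 X T c ω : ℂ)) * Complex.exp (-s₃ * (H3 X T c ω : ℂ)) *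
        Complex.exp (-s₄ * (H4 X T c ω : ℂ)) * (y ^ N1L X c ω * v ^ (X (start1 X c ω) ω).nS)
        ∂cond P (fullStart X k c) =
      A (s₂ + lamL * (1 - y)) * B (s₃ + lamL * (1 - y)) *
        C (s₄ + lamL * (1 - y) + lamS * (1 - v)) := by
  have := cond_isProbabilityMeasure hc
  choose! r hr1 hr using fun (ξ : ℂ) (hξ : 0 ≤ ξ.re) => exists_busy_root hlamS hlt hξ
  choose! g hg1 hg using fun (ξ : ℂ) (hξ : 0 ≤ ξ.re) => exists_passage_transform hlamS hmuS hlt hξ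
  choose! e he1 he using fun (ξ : ℂ) (hξ : 0 ≤ ξ.re) => exists_service_transform hmuS hξ
  -- These are the factors of `serviceFun` at the start of the cycle, where `nL = 0`. Only `A`
  -- averages over the initial state; phases 3 and 4 start from the fixed levels `k - 1` and `l`, so
  -- their factors come out of the integral.
  refine ⟨fun ξ => ∫ ω, r ξ ^ ((X (start2 X c ω) ω).nS + 1 - k) ∂cond P (fullStart X k c),
    fun ξ => ∏ i ∈ Finset.Ioc l (k - 1), g ξ i, fun ξ => ∏ i ∈ Finset.Icc 1 l, e ξ i,
    fun s₂ s₃ s₄ y v hs₂ hs₃ hs₄ hy hv => ?_⟩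
  have hy' := re_mul_one_sub_nonneg hlamL.le hy
  have hv' := re_mul_one_sub_nonneg hlamS.le hv
  have hξ₂ : 0 ≤ (s₂ + lamL * (1 - y)).re := by rw [Complex.add_re]; linarith
  have hξ₃ : 0 ≤ (s₃ + lamL * (1 - y)).re := by rw [Complex.add_re]; linarith
  have hξ₄ : 0 ≤ (s₄ + lamL * (1 - y) + lamS * (1 - v)).re := by
    rw [Complex.add_re, Complex.add_re]; linarith
  let σ : Phase → ℂ := fun p => match p with
    | .one => 0
    | .two => s₂
    | .three => s₃
    | .four => s₄
  have hσ : ∀ p, 0 ≤ (σ p).re := by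
    intro p
    cases p
    · exact le_rfl
    · exact hs₂
    · exact hs₃
    · exact hs₄
  have hone := h.ae_hits_one (c := c) hk hl hlamS hlamL hmuS hmuL hlt hc
  have hstart := h.ae_fullStart (c := c) hlamS hlamL hmuS hmuL
  have key := (h.shift_fullStart (c := c) hlamS hlamL hmuS hmuL).2.integral_optional_stopping
    hlamS hlamL hmuS hmuL (invariant_serviceStates hk hl) hσ
    (norm_serviceFun_le k l hy hv (hr1 _ hξ₂) (hg1 _ hξ₃) (he1 _ hξ₄))
    (fun x hx hA ho => serviceFun_advance hk hl _ _ _ _ _ hx hA ho)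
    (fun x hx hA ho => serviceFun_harmonic hk hl (σ := σ) (by have := hr _ hξ₂; exact_mod_cast this)
      (hg _ hξ₃) (he _ hξ₄) hx hA ho)
    (h.ae_start_mem hlamS hlamL hmuS hmuL) hone
  calc _ = _ := integral_congr_ae ?_
    _ = _ := key
    _ = _ := ?_
  · filter_upwards [hone, hstart] with ω h1 hω
    obtain ⟨h2, -, h3, h4, -⟩ := hω
    rw [h2] at h1
    rw [h2]
    have e1 := prod_exp_eq (T := T) c h3 h4 h1 σ
    have e2 := start1_eq_add c h3 h4 h1
    have e3 := (start_spec c h3 h4 h1).2.1.2.2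
    rw [← e1]
    rw [← e2]
    simp only [serviceFun, e3, N1L]
  · rw [← integral_mul_const, ← integral_mul_const]
    refine integral_congr_ae ?_
    filter_upwards [hstart] with ω hω
    obtain ⟨h2, -, -, h4, -, h5, -⟩ := hω
    rw [h2, Nat.add_zero]
    simp only [serviceFun, h4, h5, pow_zero, one_mul]

/-- The state at the beginning of phase 1. -/
lemma IsRun.ae_start1 (h : IsRun k l lamS lamL muS muL P X T) (hk : 2 ≤ k) (hl : l < k)
    (hlamS : 0 < lamS) (hlamL : 0 < lamL) (hmuS : 0 < muS) (hmuL : 0 < muL)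
    (hlt : lamS < k * muS) (hc : P (fullStart X k c) ≠ 0) :
    ∀ᵐ ω ∂cond P (fullStart X k c),
      start1 X c ω = fullStartStep X k c ω +
        sInf {n | (X (fullStartStep X k c ω + n) ω).phase = .one} ∧
      (X (start1 X c ω) ω).phase = .one ∧ X (start1 X c ω) ω ∈ largeStates := by
  have := isProbabilityMeasure_holdLaw (k := k) (l := l) hlamS hlamL hmuS hmuL
  have hinv := (h.shift_fullStart (c := c) hlamS hlamL hmuS hmuL).2.ae_mem_of_invariant
    (A := {x | x.phase = .one}) (R := serviceStates k l)
    (fun x hx hA y hy => (invariant_serviceStates hk hl).mem hx hA hy)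
    (h.ae_start_mem hlamS hlamL hmuS hmuL)
  filter_upwards [h.ae_hits_one (c := c) hk hl hlamS hlamL hmuS hmuL hlt hc,
    h.ae_fullStart (c := c) hlamS hlamL hmuS hmuL, hinv] with ω h1 hω h5
  obtain ⟨h2, -, h3, h4, -⟩ := hω
  have h6 := h5 (sInf {n | (X (fullStartStep X k c ω + n) ω).phase = .one})
    fun i hi => Nat.notMem_of_lt_sInf hi
  rw [h2] at h1 h6 ⊢
  have e2 := start1_eq_add c h3 h4 h1
  have e3 := (start_spec c h3 h4 h1).2.1.2.2
  rw [← e2] at h6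
  refine ⟨e2, e3, Or.inl ⟨e3, ?_⟩⟩
  rw [mem_serviceStates, e3] at h6
  exact h6

/-- The run from the beginning of phase 1 on. -/
lemma IsRun.shift_start1 (h : IsRun k l lamS lamL muS muL P X T) (hk : 2 ≤ k) (hl : l < k)
    (hlamS : 0 < lamS) (hlamL : 0 < lamL) (hmuS : 0 < muS) (hmuL : 0 < muL)
    (hlt : lamS < k * muS) (hc : P (fullStart X k c) ≠ 0) :
    ∃ (X' : ℕ → Ω → State) (T' : ℕ → Ω → ℝ),
      IsRun k l lamS lamL muS muL (cond P (fullStart X k c)) X' T' ∧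
      ∀ᵐ ω ∂cond P (fullStart X k c), ∀ i, X' i ω = X (start1 X c ω + i) ω := by
  have := isProbabilityMeasure_holdLaw (k := k) (l := l) hlamS hlamL hmuS hmuL
  have hrun := (h.shift_fullStart (c := c) hlamS hlamL hmuS hmuL).2
  have hone := h.ae_hits_one (c := c) hk hl hlamS hlamL hmuS hmuL hlt hc
  have hshift := (IsJumpProcess.shift hrun
    (F := {ω | ∃ n, (X (fullStartStep X k c ω + n) ω).phase = .one})
    (N := fun ω => sInf {n | (X (fullStartStep X k c ω + n) ω).phase = .one})
    ?_ ?_).2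
  -- Phase 1 is reached almost surely, so restricting to that event, as the strong Markov property
  -- requires, changes nothing.
  · have hres : (cond P (fullStart X k c)).restrict
        {ω | ∃ n, (X (fullStartStep X k c ω + n) ω).phase = .one} = cond P (fullStart X k c) :=
      Measure.restrict_eq_self_of_ae_mem hone
    rw [hres] at hshift
    refine ⟨_, _, hshift, ?_⟩
    filter_upwards [h.ae_start1 hk hl hlamS hlamL hmuS hmuL hlt hc] with ω hω i
    rw [hω.1, Nat.add_assoc]
  · rintro n ω ω' he ⟨h1, rfl⟩
    beta_reduce at he
    have h3 : (X (fullStartStep X k c ω' +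
        sInf {n | (X (fullStartStep X k c ω + n) ω).phase = .one}) ω').phase = .one := by
      rw [← he _ le_rfl]
      exact Nat.sInf_mem h1
    refine ⟨⟨_, h3⟩, le_antisymm (Nat.sInf_le h3) ?_⟩
    by_contra hlt
    push Not at hlt
    have h4 := Nat.sInf_mem (s := {n | (X (fullStartStep X k c ω' + n) ω').phase = .one}) ⟨_, h3⟩
    refine Nat.notMem_of_lt_sInf hlt ?_
    rw [Set.mem_ofPred_eq] at h4 ⊢
    rw [he _ hlt.le]
    exact h4
  · intro ω hω
    have : {n | (X (fullStartStep X k c ω + n) ω).phase = .one} = ∅ := by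
      ext n
      simpa using fun h' => hω ⟨n, h'⟩
    simp only [this, Nat.sInf_empty]

lemma IsRun.ae_hits_two (h : IsRun k l lamS lamL muS muL P X T) (hk : 2 ≤ k) (hl : l < k)
    (hlamS : 0 < lamS) (hlamL : 0 < lamL) (hmuS : 0 < muS) (hmuL : 0 < muL)
    (hlt : lamS < k * muS) (hltL : lamL < muL) (hc : P (fullStart X k c) ≠ 0) :
    ∀ᵐ ω ∂cond P (fullStart X k c), ∃ n, (X (start1 X c ω + n) ω).phase = .two := by
  have := cond_isProbabilityMeasure hc
  obtain ⟨X', T', hrun, heq⟩ := h.shift_start1 hk hl hlamS hlamL hmuS hmuL hlt hc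
  have h0 : ∀ᵐ ω ∂cond P (fullStart X k c), X' 0 ω ∈ largeStates := by
    filter_upwards [heq, h.ae_start1 hk hl hlamS hlamL hmuS hmuL hlt hc] with ω h1 h2
    rw [h1]
    exact h2.2.2
  filter_upwards [heq, hrun.ae_exists_phase_two hlamS hlamL hmuS hmuL hltL h0] with ω h1 h2
  simpa only [h1] using h2

/-- The transform of the number of small jobs at the end of phase 1. -/
lemma IsRun.zTransform_N2S (h : IsRun k l lamS lamL muS muL P X T) (hk : 2 ≤ k) (hl : l < k)
    (hlamS : 0 < lamS) (hlamL : 0 < lamL) (hmuS : 0 < muS) (hmuL : 0 < muL)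
    (hlt : lamS < k * muS) (hltL : lamL < muL) (hc : P (fullStart X k c) ≠ 0) {z r : ℂ}
    (hz : ‖z‖ ≤ 1) (hr1 : ‖r‖ ≤ 1)
    (hr : lamL * r ^ 2 + muL = (lamL + muL + lamS * (1 - z)) * r) :
    zTransform (cond P (fullStart X k c)) (N2S X c) z =
      ∫ ω, r ^ N1L X c ω * z ^ (X (start1 X c ω) ω).nS ∂cond P (fullStart X k c) := by
  have := cond_isProbabilityMeasure hc
  obtain ⟨X', T', hrun, heq⟩ := h.shift_start1 hk hl hlamS hlamL hmuS hmuL hlt hc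
  have hs := h.ae_start1 hk hl hlamS hlamL hmuS hmuL hlt hc
  have key := hrun.integral_phase_two hlamS hlamL hmuS hmuL hltL
    (by filter_upwards [heq, hs] with ω h1 h2; rw [h1]; exact h2.2.2) hz hr1 hr
    (by filter_upwards [heq, hs] with ω h1 h2; rw [h1]; exact h2.2.1)
  calc _ = _ := integral_congr_ae ?_
    _ = _ := key
    _ = _ := integral_congr_ae ?_
  · filter_upwards [heq, h.ae_hits_two hk hl hlamS hlamL hmuS hmuL hlt hltL hc] with ω h1 h2
    simp only [h1, N2S, start2']
    rw [firstFrom_eq_add h2]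
  · filter_upwards [heq] with ω h1
    simp only [h1, N1L, Nat.add_zero]

end Cycle

end MSFQ

/-! ### The two transform identities -/

theorem mainTheorem7 {Ω Ω' : Type*} [MeasurableSpace Ω] [MeasurableSpace Ω']
    (k l : ℕ) (hk : 2 ≤ k) (hl : l < k)
    (lamS lamL muS muL : ℝ) (hlamS : 0 < lamS) (hlamL : 0 < lamL) (hmuS : 0 < muS) (hmuL : 0 < muL)
    (hstable : lamS / (k * muS) + lamL / muL < 1)
    -- a run of the MSFQ system, with an arbitrary initial law
    (P : MeasureTheory.Measure Ω) [MeasureTheory.IsProbabilityMeasure P]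
    (X : ℕ → Ω → MSFQ.State) (T : ℕ → Ω → ℝ) (hX : MSFQ.IsRun k l lamS lamL muS muL P X T)
    -- an M/M/1 queue of large jobs, started by one job
    (Q : MeasureTheory.Measure Ω') [MeasureTheory.IsProbabilityMeasure Q]
    (Y : ℕ → Ω' → ℕ) (U : ℕ → Ω' → ℝ) (hY : MSFQ.IsMM1FromOne lamL muL Q Y U)
    -- a cycle, given that its phase 2 begins with at least `k` small jobs
    (c : ℕ) (hc : P (MSFQ.fullStart X k c) ≠ 0)
    (P' : MeasureTheory.Measure Ω)
    (hP' : P' = ProbabilityTheory.cond P (MSFQ.fullStart X k c))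
    (β : ℂ → ℂ) (hβ : ∀ z, β z = MSFQ.lst Q (MSFQ.busyPeriod Y U) (lamS * (1 - z))) :
    (∀ᵐ ω ∂P', MSFQ.CycleEnds X c ω) ∧
    (∀ᵐ ω ∂Q, ∃ n, Y n ω = 0) ∧
    ∀ z : ℂ, ‖z‖ ≤ 1 →
      MSFQ.zTransform P' (MSFQ.N1L X c) z =
        MSFQ.lst P' (MSFQ.H2 X T c) (lamL * (1 - z)) *
        MSFQ.lst P' (MSFQ.H3 X T c) (lamL * (1 - z)) *
        MSFQ.lst P' (MSFQ.H4 X T c) (lamL * (1 - z)) ∧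
      MSFQ.zTransform P' (MSFQ.N2S X c) z =
        MSFQ.lst P' (MSFQ.H2 X T c) (lamL * (1 - β z)) *
        MSFQ.lst P' (MSFQ.H3 X T c) (lamL * (1 - β z)) *
        MSFQ.lst P' (MSFQ.H4 X T c) (lamL * (1 - β z) + lamS * (1 - z)) := by
  subst hP'
  have hk0 : (0 : ℝ) < k := by exact_mod_cast (by omega : 0 < k)
  -- Both loads are positive, so each of them alone is below one.
  have hltL : lamL < muL := by
    have : 0 < lamS / (k * muS) := by positivity
    rw [← div_lt_one hmuL]
    linarith
  have hlt : lamS < k * muS := by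
    have : 0 < lamL / muL := by positivity
    rw [← div_lt_one (by positivity)]
    linarith
  have hprob := ProbabilityTheory.cond_isProbabilityMeasure hc
  refine ⟨?_, MSFQ.mm1_ae_empty hlamL hltL hY, fun z hz => ?_⟩
  · filter_upwards [hX.ae_hits_one (c := c) hk hl hlamS hlamL hmuS hmuL hlt hc,
      hX.ae_fullStart (c := c) hlamS hlamL hmuS hmuL,
      hX.ae_hits_two hk hl hlamS hlamL hmuS hmuL hlt hltL hc] with ω h1 hω h6
    obtain ⟨h2, h3, h4, h5, -⟩ := hω
    rw [h2] at h1
    obtain ⟨⟨a1, a2, a3⟩, ⟨b1, b2, b3⟩, -⟩ := MSFQ.start_spec c h4 h5 h1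
    obtain ⟨n, hn⟩ := h6
    exact ⟨_, _, _, _, _, h3, a1, a2, a3, Nat.le_add_right _ n, b1, b2, b3, hn⟩
  · obtain ⟨A, B, C, hABC⟩ := hX.exists_cycle_transform (c := c) hk hl hlamS hlamL hmuS hmuL hlt hc
    have h0 : (0 : ℝ) ≤ (0 : ℂ).re := le_rfl
    have h1 : ‖(1 : ℂ)‖ ≤ 1 := by simp
    -- With no discount and no weights, the joint transform is the total mass of the conditional
    -- law.
    have e1 : 1 = A 0 * B 0 * C 0 := by simpa using hABC 0 0 0 1 1 h0 h0 h0 h1 h1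
    have e2 : ∀ s : ℂ, 0 ≤ s.re →
        MSFQ.lst (ProbabilityTheory.cond P (MSFQ.fullStart X k c)) (MSFQ.H2 X T c) s =
          A s * B 0 * C 0 := fun s hs => by
      simpa [MSFQ.lst] using hABC s 0 0 1 1 hs h0 h0 h1 h1
    have e3 : ∀ s : ℂ, 0 ≤ s.re →
        MSFQ.lst (ProbabilityTheory.cond P (MSFQ.fullStart X k c)) (MSFQ.H3 X T c) s =
          A 0 * B s * C 0 := fun s hs => by
      simpa [MSFQ.lst] using hABC 0 s 0 1 1 h0 hs h0 h1 h1
    have e4 : ∀ s : ℂ, 0 ≤ s.re →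
        MSFQ.lst (ProbabilityTheory.cond P (MSFQ.fullStart X k c)) (MSFQ.H4 X T c) s =
          A 0 * B 0 * C s := fun s hs => by
      simpa [MSFQ.lst] using hABC 0 0 s 1 1 h0 h0 hs h1 h1
    -- The right side carries the extra factor `(A 0 * B 0 * C 0) ^ 2`, which is one by `e1`.
    have e5 : ∀ a b d : ℂ, A a * B b * C d =
        (A a * B 0 * C 0) * (A 0 * B b * C 0) * (A 0 * B 0 * C d) := fun a b d => by
      linear_combination (A a * B b * C d) * (1 + A 0 * B 0 * C 0) * e1
    have hzL := MSFQ.re_mul_one_sub_nonneg hlamL.le hz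
    have hzS := MSFQ.re_mul_one_sub_nonneg hlamS.le hz
    -- One root plays two roles: it is the busy-period transform `β z`, and it is the weight per
    -- large job in phase 1. Its bound `‖r‖ ≤ 1` keeps `lamL * (1 - r)` in the closed right
    -- half-plane.
    obtain ⟨r, hr1, hr⟩ := MSFQ.exists_busy_root hlamL hltL hzS
    have hβr : β z = r := by rw [hβ, MSFQ.mm1_lst_busyPeriod hlamL hltL hY hzS hr1 hr]
    have hrL := MSFQ.re_mul_one_sub_nonneg hlamL.le hr1
    constructor
    · rw [e2 _ hzL, e3 _ hzL, e4 _ hzL, ← e5]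
      simpa [MSFQ.zTransform] using hABC 0 0 0 z 1 h0 h0 h0 hz h1
    · rw [hβr, e2 _ hrL, e3 _ hrL, e4 _ (by rw [Complex.add_re]; linarith), ← e5,
        hX.zTransform_N2S hk hl hlamS hlamL hmuS hmuL hlt hltL hc hz hr1 hr]
      simpa using hABC 0 0 0 r z h0 h0 h0 hr1 hz
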